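/- Let $K$ be an algebraically closed field (of any characteristic), $R=K[x_0,x_1,x_2]=K[\mathbb P^2]$, and let $A=m_1p_1+\dots+m_sp_s\subset\mathbb P^2$ be a fat point scheme: the $p_i$ are distinct points, $m_i\ge 0$, and $I_A=\bigcap_i I_{p_i}^{m_i}$, where $I_{p_i}\subset R$ is generated by the forms vanishing at $p_i$. For a homogeneous ideal $I_Z\subset R$ defining $Z$ write $h_{I_Z}(t)=\dim_K (I_Z)_t$, $h_Z(t)=\dim_K (R/I_Z)_t$ (both $0$ for $t<0$), and $\Delta h_Z(t)=h_Z(t)-h_Z(t-1)$. Let $L_1,\dots,L_r$ be lines, not necessarily distinct, with linear forms $F_1,\dots,F_r$. Let $A_0=A$ and let $A_i=A_{i-1}:L_i$ be the residual scheme, defined by $I_{A_i}=(I_{A_{i-1}}:F_i)$. Assume that the sequence totally reduces $A$, i.e. $A_r=\varnothing$ ($I_{A_r}=R$), and that the reduction vector $\mathbf d=(d_1,\dots,d_r)$, $d_i=\deg(L_i\cap A_{i-1})$, is GMS: it is non-negative, non-increasing, and $d_i-d_k\ge k-i-1$ for all $i<k$. Let $\alpha(I_A)$ be the least $t\ge 0$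 with $(I_A)_t\ne0$ and $\operatorname{reg}(I_A)$ the least $t\ge 0$ with $h_A(t-1)=\deg A$; here the degree of a zero-dimensional or empty scheme $Z$ is the value of $h_Z(t)$ for all large $t$. Let $t$ be an integer with $\alpha(I_A)\le t<\operatorname{reg}(I_A)$, and let $j=j(\mathbf d,t)$ be the greatest integer in $0\le j\le r$ such that $h_{I_{A_i}}(t-i)=h_{I_A}(t)$ for all $1\le i\le j$. Let $\nu_{t+1}(A)$ be the number of generators of degree $t+1$ in a minimal set of homogeneous generators of $I_A$; explicitly, it is the dimension of the cokernel of the multiplication map $(I_A)_t\otimes_K R_1\to (I_A)_{t+1}$. Put $e=\Delta h_{A_j}(t-j)$. Then $H^1(\mathbb P^2,\mathcal I_{A_j}(t-j-1))$ is finite-dimensional of dimension $e$, and $$\bigl(h_{I_A}(t+1)-h_{I_{A_j}}(t-j+1)\bigr)+\max(2e-t+j,0)\;\le\;\nu_{t+1}(A)\;\le\;\bigl(h_{I_A}(t+1)-h_{I_{A_j}}(t-j+1)\bigr)+e .$$ -/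

import Mathlib

open MvPolynomial Filter
open scoped LinearAlgebra.Projectivization

noncomputable section

namespace PlaneFatPoints

variable {K : Type*} [Field K]

/-- `R_n` for `R = K[x₀, x₁, x₂]` with its standard grading, for every integer `n`
(zero if `n < 0`). -/
def forms (K : Type*) [Field K] (n : ℤ) : Submodule K (MvPolynomial (Fin 3) K) :=
  weightedHomogeneousSubmodule K (fun _ : Fin 3 => (1 : ℤ)) n

/-- In natural degrees `forms` is Mathlib's space of homogeneous polynomials. -/
theorem forms_natCast (n : ℕ) : forms K (n : ℤ) = homogeneousSubmodule (Fin 3) K n := by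
  ext f
  have key : ∀ d : Fin 3 →₀ ℕ, Finsupp.weight (fun _ : Fin 3 => (1 : ℤ)) d = (n : ℤ) ↔
      Finsupp.weight (1 : Fin 3 → ℕ) d = n := by
    intro d
    rw [Finsupp.weight_apply, Finsupp.weight_apply, Finsupp.sum_fintype _ _ (by simp),
      Finsupp.sum_fintype _ _ (by simp)]
    simp only [Fin.sum_univ_three, Pi.one_apply, nsmul_eq_mul, smul_eq_mul, mul_one]
    norm_cast
  constructor
  · intro h d hd
    exact (key d).1 (h hd)
  · intro h d hd
    exact (key d).2 (h hd)

/-- In negative degrees there are no nonzero forms. -/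
theorem forms_of_neg {n : ℤ} (hn : n < 0) : forms K n = ⊥ := by
  rw [eq_bot_iff]
  intro f hf
  rw [Submodule.mem_bot]
  ext d
  by_contra hd
  have h := hf hd
  rw [Finsupp.weight_apply, Finsupp.sum_fintype _ _ (by simp)] at h
  simp only [Fin.sum_univ_three, nsmul_eq_mul, mul_one] at h
  omega

/-- The graded piece `I_n = I ∩ R_n`. -/
def piece (I : Ideal (MvPolynomial (Fin 3) K)) (n : ℤ) : Submodule K (MvPolynomial (Fin 3) K) :=
  I.restrictScalars K ⊓ forms K n

/-- The Hilbert function of the ideal, `n ↦ dim_K I_n` (zero for `n < 0`). -/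
def hilbIdeal (I : Ideal (MvPolynomial (Fin 3) K)) (n : ℤ) : ℕ :=
  Module.finrank K (piece I n)

/-- The Hilbert function of the quotient, `n ↦ dim_K (R_n / I_n)` (zero for `n < 0`). -/
def hilbQuot (I : Ideal (MvPolynomial (Fin 3) K)) (n : ℤ) : ℕ :=
  Module.finrank K (forms K n ⧸ (piece I n).submoduleOf (forms K n))

/-- The first difference of `hilbQuot`. As `hilbQuot I (-1) = 0`, its value at `0` is
`hilbQuot I 0`. -/
def deltaHilbQuot (I : Ideal (MvPolynomial (Fin 3) K)) (n : ℤ) : ℤ :=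
  (hilbQuot I n : ℤ) - (hilbQuot I (n - 1) : ℤ)

/-- The degree of the zero-dimensional (or empty) subscheme of the plane defined by a homogeneous
ideal: the value of the (constant) Hilbert polynomial, that is, the number `d` with
`dim (R/I)_n = d` for all large `n`. -/
def degree (I : Ideal (MvPolynomial (Fin 3) K)) : ℕ :=
  sInf {d : ℕ | ∀ᶠ n : ℕ in atTop, hilbQuot I (n : ℤ) = d}

/-- The least degree in which `I` has a nonzero form. -/
def initialDegree (I : Ideal (MvPolynomial (Fin 3) K)) : ℕ :=
  sInf {t : ℕ | piece I (t : ℤ) ≠ ⊥}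

/-- The regularity of the ideal of a fat point scheme: the least `t ≥ 0` for which
`dim (R/I)_{t-1}` is the degree of the scheme. -/
def regularity (I : Ideal (MvPolynomial (Fin 3) K)) : ℕ :=
  sInf {t : ℕ | hilbQuot I ((t : ℤ) - 1) = degree I}

/-- The dimension of the cokernel of the multiplication map `I_t ⊗ R_1 → I_{t+1}`: this is the
number `ν_{t+1}` of generators of degree `t + 1` in a minimal set of homogeneous generators.
(The product of submodules is the span of the products, that is, the image of that map.) -/
def nuSucc (I : Ideal (MvPolynomial (Fin 3) K)) (t : ℕ) : ℕ :=
  Module.finrank K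
    (piece I ((t : ℤ) + 1) ⧸ (piece I (t : ℤ) * forms K 1).submoduleOf (piece I ((t : ℤ) + 1)))

/-! ### Fat point schemes and their residuals -/

/-- A fat point scheme `∑ mᵢ pᵢ` in the plane: a multiplicity for each point of the plane,
zero for all but finitely many points. -/
abbrev FatPointScheme (K : Type*) [Field K] := ℙ K (Fin 3 → K) →₀ ℕ

/-- The ideal generated by all forms that vanish at `p`. -/
def pointIdeal (p : ℙ K (Fin 3 → K)) : Ideal (MvPolynomial (Fin 3) K) :=
  Ideal.span {f | (∃ n : ℕ, f.IsHomogeneous n) ∧ eval p.rep f = 0}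

/-- The ideal `⋂ I_p ^ m_p` of a fat point scheme. -/
def FatPointScheme.ideal (A : FatPointScheme K) : Ideal (MvPolynomial (Fin 3) K) :=
  ⨅ p ∈ A.support, pointIdeal p ^ A p

/-- The ideals of the successive residuals `A_0 = A`, `A_{i+1} = A_i : L_{i+1}`, where the line
`L_{i+1}` is given by the linear form `F i`, and `I_{A : L} = (I_A : F)`. -/
def residualIdeal (A : FatPointScheme K) {r : ℕ} (F : Fin r → MvPolynomial (Fin 3) K) :
    Fin (r + 1) → Ideal (MvPolynomial (Fin 3) K) :=
  Fin.induction A.ideal (fun i J => J.colon {F i})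

/-- The last residual is the empty scheme. -/
def TotallyReduces (A : FatPointScheme K) {r : ℕ} (F : Fin r → MvPolynomial (Fin 3) K) : Prop :=
  residualIdeal A F (Fin.last r) = ⊤

/-- The entry `d_{i+1}` (here with index `i : Fin r`) is the degree of the scheme theoretic
intersection `L_{i+1} ∩ A_i`. -/
def reductionVector (A : FatPointScheme K) {r : ℕ} (F : Fin r → MvPolynomial (Fin 3) K) :
    Fin r → ℤ :=
  fun i => (degree (residualIdeal A F i.castSucc ⊔ Ideal.span {F i}) : ℤ)

/-- Non-negative, non-increasing, and `v i - v j ≥ j - i - 1` for `i < j`. -/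
def IsGMS {r : ℕ} (v : Fin r → ℤ) : Prop :=
  (∀ i, 0 ≤ v i) ∧ Antitone v ∧
    ∀ i j : Fin r, i < j → ((j : ℕ) : ℤ) - ((i : ℕ) : ℤ) - 1 ≤ v i - v j

/-! ### First cohomology of the twisted ideal sheaf, by the Čech complex of the standard cover -/

/-- For nonempty `s`, the sections over `{∏_{i ∈ s} xᵢ ≠ 0}` of the twist by `m` of the sheaf
associated with the homogeneous ideal `I`: the degree `m` part of the localization of `I` at
`P = ∏_{i ∈ s} xᵢ`, inside the fraction field of `R`. It consists of the fractions `g / P ^ N`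
with `g ∈ I` a form of degree `m + N · |s|`. -/
def sections (I : Ideal (MvPolynomial (Fin 3) K)) (m : ℤ) (s : Finset (Fin 3)) :
    Submodule K (FractionRing (MvPolynomial (Fin 3) K)) where
  carrier := {f | ∃ N : ℕ, ∃ g ∈ piece I (m + (N : ℤ) * (s.card : ℤ)),
    f = algebraMap (MvPolynomial (Fin 3) K) (FractionRing (MvPolynomial (Fin 3) K)) g /
      algebraMap (MvPolynomial (Fin 3) K) (FractionRing (MvPolynomial (Fin 3) K))
        ((∏ i ∈ s, X i) ^ N)}
  zero_mem' := ⟨0, 0, Submodule.zero_mem _, by simp⟩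
  smul_mem' := by
    rintro c f ⟨N, g, hg, rfl⟩
    refine ⟨N, c • g, Submodule.smul_mem _ c hg, ?_⟩
    rw [Algebra.smul_def, Algebra.smul_def, map_mul, mul_div_assoc,
      ← IsScalarTower.algebraMap_apply]
  add_mem' := by
    rintro f f' ⟨N, g, hg, rfl⟩ ⟨N', g', hg', rfl⟩
    have hP0 : (∏ i ∈ s, (X i : MvPolynomial (Fin 3) K)) ≠ 0 :=
      Finset.prod_ne_zero_iff.2 fun i _ => X_ne_zero i
    have hne : ∀ k : ℕ, algebraMap (MvPolynomial (Fin 3) K)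
        (FractionRing (MvPolynomial (Fin 3) K)) ((∏ i ∈ s, X i) ^ k) ≠ 0 := fun k h =>
      pow_ne_zero k hP0 ((map_eq_zero_iff _ (IsFractionRing.injective _ _)).1 h)
    have hP : ∀ k : ℕ, IsWeightedHomogeneous (fun _ : Fin 3 => (1 : ℤ))
        ((∏ i ∈ s, (X i : MvPolynomial (Fin 3) K)) ^ k) ((k : ℤ) * (s.card : ℤ)) := by
      intro k
      have h1 := (IsWeightedHomogeneous.prod s (fun i => (X i : MvPolynomial (Fin 3) K))
        (fun _ => (1 : ℤ)) (w := fun _ : Fin 3 => (1 : ℤ))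
        fun i _ => isWeightedHomogeneous_X K (fun _ : Fin 3 => (1 : ℤ)) i).pow k
      simpa using h1
    refine ⟨N + N', g * (∏ i ∈ s, X i) ^ N' + g' * (∏ i ∈ s, X i) ^ N, ?_, ?_⟩
    · refine Submodule.add_mem _ ⟨I.mul_mem_right _ hg.1, ?_⟩ ⟨I.mul_mem_right _ hg'.1, ?_⟩
      · have h2 := IsWeightedHomogeneous.mul hg.2 (hP N')
        have e : m + (N : ℤ) * (s.card : ℤ) + (N' : ℤ) * (s.card : ℤ) =
            m + ((N + N' : ℕ) : ℤ) * (s.card : ℤ) := by push_cast; ring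
        rw [e] at h2
        exact h2
      · have h2 := IsWeightedHomogeneous.mul hg'.2 (hP N)
        have e : m + (N' : ℤ) * (s.card : ℤ) + (N : ℤ) * (s.card : ℤ) =
            m + ((N + N' : ℕ) : ℤ) * (s.card : ℤ) := by push_cast; ring
        rw [e] at h2
        exact h2
    · have h3 := hne N
      have h4 := hne N'
      rw [div_add_div _ _ h3 h4, pow_add, map_mul, map_add, map_mul, map_mul]
      ring

/-- Čech 1-cocycles `(f i j)` for the cover by the sets `xᵢ ≠ 0`. -/
def cechCocycles (I : Ideal (MvPolynomial (Fin 3) K)) (m : ℤ) :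
    Submodule K (Fin 3 → Fin 3 → FractionRing (MvPolynomial (Fin 3) K)) where
  carrier := {f | (∀ i j, f i j ∈ sections I m {i, j}) ∧ ∀ i j k, f i j + f j k = f i k}
  zero_mem' := ⟨fun _ _ => Submodule.zero_mem _, fun _ _ _ => by simp⟩
  add_mem' := by
    rintro f g ⟨hf, hf'⟩ ⟨hg, hg'⟩
    refine ⟨fun i j => Submodule.add_mem _ (hf i j) (hg i j), fun i j k => ?_⟩
    simp only [Pi.add_apply]
    rw [← hf' i j k, ← hg' i j k]
    ring
  smul_mem' := by
    rintro c f ⟨hf, hf'⟩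
    refine ⟨fun i j => Submodule.smul_mem _ c (hf i j), fun i j k => ?_⟩
    simp only [Pi.smul_apply]
    rw [← hf' i j k, smul_add]

/-- Čech 1-coboundaries `f i j = g j - g i`. -/
def cechCoboundaries (I : Ideal (MvPolynomial (Fin 3) K)) (m : ℤ) :
    Submodule K (Fin 3 → Fin 3 → FractionRing (MvPolynomial (Fin 3) K)) where
  carrier := {f | ∃ g : Fin 3 → FractionRing (MvPolynomial (Fin 3) K),
    (∀ i, g i ∈ sections I m {i}) ∧ ∀ i j, f i j = g j - g i}
  zero_mem' := ⟨0, fun _ => Submodule.zero_mem _, fun _ _ => by simp⟩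
  add_mem' := by
    rintro f f' ⟨g, hg, h⟩ ⟨g', hg', h'⟩
    refine ⟨g + g', fun i => Submodule.add_mem _ (hg i) (hg' i), fun i j => ?_⟩
    simp only [Pi.add_apply]
    rw [h, h']
    ring
  smul_mem' := by
    rintro c f ⟨g, hg, h⟩
    refine ⟨c • g, fun i => Submodule.smul_mem _ c (hg i), fun i j => ?_⟩
    simp only [Pi.smul_apply]
    rw [h, smul_sub]

/-- `H¹(ℙ², 𝓘(m))` for the ideal sheaf `𝓘` defined by the homogeneous ideal `I`. -/
abbrev cechH1 (I : Ideal (MvPolynomial (Fin 3) K)) (m : ℤ) : Type _ :=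
  cechCocycles I m ⧸ (cechCoboundaries I m).submoduleOf (cechCocycles I m)

end PlaneFatPoints

end

/-! Write J for the ideal of A_j, u = t - j and G = F_1⋯F_j. Multiplication by G embeds J_u in
(I_A)_t, and equality of dimensions makes it onto, so (I_A)_t R_1 = G·(J_u R_1)
(`finrank_mul_forms_one_eq`). Hence ν_{t+1}(A) is h_{I_A}(t+1) - h_J(u+1) plus the defect h_J(u+1) -
dim J_u R_1, and it remains to place the defect between max(2e - u, 0) and e.

If j < r, maximality of j says that L_{j+1} is not a fixed component of J_u, which forces d_{j+1} ≤
u (`IsPointsIdeal.degree_sup_le_of_ne`). The GMS inequalities then bound every later d_k, and adding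
up h_Z(n) = h_{Z:L}(n-1) + h_{Z∩L}(n) along the residuals shows that h_{A_j} is constant from degree
u on (`hilbQuot_residualIdeal_eq`). For j = r the residual is empty and this is clear.

Choose a line x = 0 missing the points of A. Then x is a nonzerodivisor modulo J, and J_u restricts
to this line in dimension u + 1 - e. The space J_u R_1 contains x J_u, and its restriction is at
least one dimension larger than that of J_u; this gives defect ≤ e. Koszul relations cut down dim
J_u R_1 and give defect ≥ 2e - u (`IsPointsIdeal.generators_bounds`).

For the cohomology, let Z = A_j. All sections of O_Z(u) come from forms, and x is invertible on Z,
so the cokernel of R_{u-1} → H⁰(O_Z(u-1)) becomes (R/(J + (x)))_u, whose dimension is e. The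
comparison is made directly on Čech cocycles (`IsPointsIdeal.nonempty_cechH1_equiv`). -/

open MvPolynomial Filter
open scoped LinearAlgebra.Projectivization

noncomputable section

namespace PlaneFatPoints

variable {K : Type*} [Field K]

/-! ### Graded pieces -/

/-- The polynomial ring is graded by its spaces of forms. -/
instance formsGradedAlgebra : GradedAlgebra (forms K) :=
  MvPolynomial.weightedGradedAlgebra K (fun _ : Fin 3 => (1 : ℤ))

theorem mul_mem_forms {a b : ℤ} {f g : MvPolynomial (Fin 3) K} (hf : f ∈ forms K a)
    (hg : g ∈ forms K b) : f * g ∈ forms K (a + b) :=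
  IsWeightedHomogeneous.mul hf hg

theorem forms_one_eq : forms K 1 = homogeneousSubmodule (Fin 3) K 1 := by
  simpa using forms_natCast (K := K) 1

theorem X_mem_forms (i : Fin 3) : (X i : MvPolynomial (Fin 3) K) ∈ forms K 1 :=
  isWeightedHomogeneous_X K _ i

theorem mem_forms_of_isHomogeneous {n : ℕ} {f : MvPolynomial (Fin 3) K} (hf : f.IsHomogeneous n) :
    f ∈ forms K n := by
  rw [forms_natCast]; exact hf

theorem linear_mem_forms {f : MvPolynomial (Fin 3) K} (hf : f.IsHomogeneous 1) :
    f ∈ forms K 1 := by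
  simpa using mem_forms_of_isHomogeneous hf

theorem pow_mem_forms {a : ℤ} {f : MvPolynomial (Fin 3) K} (hf : f ∈ forms K a) (n : ℕ) :
    f ^ n ∈ forms K (n * a) := by
  have h := IsWeightedHomogeneous.pow hf n
  rw [nsmul_eq_mul] at h
  exact h

theorem exists_nat_of_mem_forms {n : ℤ} {f : MvPolynomial (Fin 3) K} (hf : f ∈ forms K n)
    (h0 : f ≠ 0) : ∃ k : ℕ, (k : ℤ) = n ∧ f.IsHomogeneous k := by
  rcases lt_or_ge n 0 with h | h
  · rw [forms_of_neg h] at hf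
    exact absurd ((Submodule.mem_bot K).1 hf) h0
  · lift n to ℕ using h
    refine ⟨n, rfl, ?_⟩
    rw [forms_natCast] at hf
    exact hf

instance finite_forms (n : ℤ) : Module.Finite K (forms K n) := by
  rcases lt_or_ge n 0 with h | h
  · rw [forms_of_neg h]; infer_instance
  · lift n to ℕ using h
    rw [forms_natCast]
    exact Module.Finite.iff_fg.2 (homogeneousSubmodule_fg (Fin 3) K n)

theorem finrank_forms_natCast (n : ℕ) :
    Module.finrank K (forms K n) = (n + 2).choose 2 := by
  have hs : {d : Fin 3 →₀ ℕ | d.degree = n} =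
      ((Finset.univ : Finset (Fin 3)).finsuppAntidiag n : Set (Fin 3 →₀ ℕ)) := by
    ext d
    simp [Finset.mem_finsuppAntidiag, Finsupp.degree_eq_sum]
  rw [forms_natCast, homogeneousSubmodule_eq_finsupp_supported, hs,
    (AddMonoidAlgebra.supportedEquivFinsupp (S := K) (R := K) _).finrank_eq,
    Module.finrank_finsupp_self, ← Nat.card_eq_fintype_card, Nat.card_coe_set_eq,
    Set.ncard_coe_finset, Finset.card_finsuppAntidiag_nat_eq_choose,
    Finset.card_fin, show 3 + n - 1 = n + 2 by omega, Nat.choose_symm_add]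

theorem finrank_forms_neg {n : ℤ} (hn : n < 0) : Module.finrank K (forms K n) = 0 := by
  rw [forms_of_neg hn]; exact finrank_bot K _

theorem finrank_forms_sub_one {n : ℤ} (hn : -1 ≤ n) :
    (Module.finrank K (forms K n) : ℤ) = Module.finrank K (forms K (n - 1)) + (n + 1) := by
  rcases hn.eq_or_lt with rfl | hn
  · rw [finrank_forms_neg (by norm_num), finrank_forms_neg (by norm_num)]; norm_num
  obtain ⟨m, rfl⟩ : ∃ m : ℕ, n = m := ⟨n.toNat, by omega⟩
  rw [finrank_forms_natCast]
  rcases m with _ | m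
  · rw [finrank_forms_neg (by norm_num)]; norm_num
  · have : ((m + 1 : ℕ) : ℤ) - 1 = m := by push_cast; ring
    rw [this, finrank_forms_natCast, show m + 1 + 2 = (m + 2) + 1 by ring, Nat.choose_succ_succ']
    push_cast
    simp
    ring

theorem piece_le_forms (I : Ideal (MvPolynomial (Fin 3) K)) (n : ℤ) : piece I n ≤ forms K n :=
  inf_le_right

theorem piece_top (n : ℤ) : piece (⊤ : Ideal (MvPolynomial (Fin 3) K)) n = forms K n := by
  ext f; simp [piece]

theorem finite_of_le_forms {V : Submodule K (MvPolynomial (Fin 3) K)} {n : ℤ}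
    (h : V ≤ forms K n) : Module.Finite K V :=
  Submodule.finiteDimensional_of_le h

instance finite_piece (I : Ideal (MvPolynomial (Fin 3) K)) (n : ℤ) :
    Module.Finite K (piece I n) :=
  finite_of_le_forms (piece_le_forms I n)

theorem finrank_quotient_submoduleOf {V W : Submodule K (MvPolynomial (Fin 3) K)}
    [Module.Finite K W] (h : V ≤ W) :
    Module.finrank K (W ⧸ V.submoduleOf W) + Module.finrank K V = Module.finrank K W := by
  rw [← (Submodule.submoduleOfEquivOfLe h).finrank_eq]
  exact Submodule.finrank_quotient_add_finrank _

theorem hilbQuot_add_hilbIdeal (I : Ideal (MvPolynomial (Fin 3) K)) (n : ℤ) :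
    hilbQuot I n + hilbIdeal I n = Module.finrank K (forms K n) :=
  finrank_quotient_submoduleOf (piece_le_forms I n)

theorem hilbQuot_neg (I : Ideal (MvPolynomial (Fin 3) K)) {n : ℤ} (hn : n < 0) :
    hilbQuot I n = 0 := by
  have := hilbQuot_add_hilbIdeal I n
  rw [finrank_forms_neg hn] at this
  omega

theorem hilbQuot_top (n : ℤ) : hilbQuot (⊤ : Ideal (MvPolynomial (Fin 3) K)) n = 0 := by
  have := hilbQuot_add_hilbIdeal (⊤ : Ideal (MvPolynomial (Fin 3) K)) n
  rw [hilbIdeal, piece_top] at this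
  omega

theorem degree_eq {I : Ideal (MvPolynomial (Fin 3) K)} {d : ℕ}
    (h : ∀ᶠ n : ℕ in atTop, hilbQuot I (n : ℤ) = d) : degree I = d := by
  have : {d : ℕ | ∀ᶠ n : ℕ in atTop, hilbQuot I (n : ℤ) = d} = {d} := by
    ext d'
    refine ⟨fun h' => ?_, fun h' => ?_⟩
    · obtain ⟨n, h1, h2⟩ := (h.and h').exists
      exact h2.symm.trans h1
    · rw [Set.mem_singleton_iff] at h'
      subst h'
      exact h
  rw [degree, this, csInf_singleton]

theorem finrank_map_mul {g : MvPolynomial (Fin 3) K} (hg : g ≠ 0)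
    (V : Submodule K (MvPolynomial (Fin 3) K)) :
    Module.finrank K (V.map (LinearMap.mulLeft K g)) = Module.finrank K V :=
  ((Submodule.equivMapOfInjective (LinearMap.mulLeft K g)
    (mul_right_injective₀ hg) V).finrank_eq).symm

/-- If F = 0 the given cofactor need not be homogeneous, so its component of degree n - a is used.
-/
theorem exists_of_dvd_of_mem_forms {a n : ℤ} {F f : MvPolynomial (Fin 3) K} (hF : F ∈ forms K a)
    (hf : f ∈ forms K n) (h : F ∣ f) : ∃ g ∈ forms K (n - a), f = F * g := by
  obtain ⟨g, rfl⟩ := h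
  refine ⟨(DirectSum.decompose (forms K) g (n - a) : MvPolynomial (Fin 3) K),
    SetLike.coe_mem _, ?_⟩
  have h1 := DirectSum.coe_decompose_mul_add_of_left_mem (forms K) (j := n - a) (b := g) hF
  rw [add_sub_cancel, DirectSum.decompose_of_mem_same _ hf] at h1
  exact h1

/-! ### Restriction to a line -/

/-- A graded endomorphism `φ` of `R` with kernel `(F)` that fixes the variables `X y`, `X z`:
the restriction to the line `F = 0`, with coordinates `X y`, `X z`. -/
structure IsRestriction (F : MvPolynomial (Fin 3) K)
    (φ : MvPolynomial (Fin 3) K →ₐ[K] MvPolynomial (Fin 3) K) (y z : Fin 3) : Prop where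
  ne : y ≠ z
  map_y : φ (X y) = X y
  map_z : φ (X z) = X z
  map_forms : ∀ n : ℤ, ∀ f ∈ forms K n, φ f ∈ forms K n
  eq_zero_iff : ∀ f, φ f = 0 ↔ F ∣ f

theorem linear_eq_sum {F : MvPolynomial (Fin 3) K} (hF : F.IsHomogeneous 1) :
    ∃ c : Fin 3 → K, F = ∑ i, C (c i) * X i := by
  have h : F ∈ Submodule.span K (Set.range (X : Fin 3 → MvPolynomial (Fin 3) K)) := by
    rw [← homogeneousSubmodule_one_eq_span_X]; exact hF
  obtain ⟨c, hc⟩ := (Submodule.mem_span_range_iff_exists_fun K).1 h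
  exact ⟨c, by rw [← hc]; simp [C_mul']⟩

theorem algHom_map_forms {g : Fin 3 → MvPolynomial (Fin 3) K} (hg : ∀ i, (g i).IsHomogeneous 1)
    {n : ℤ} {f : MvPolynomial (Fin 3) K} (hf : f ∈ forms K n) : aeval g f ∈ forms K n := by
  rcases eq_or_ne f 0 with rfl | h0
  · simp
  obtain ⟨k, rfl, hk⟩ := exists_nat_of_mem_forms hf h0
  refine mem_forms_of_isHomogeneous ?_
  simpa using hk.aeval g hg

/-- Eliminate a variable `X i` with nonzero coefficient in F: the substitution X i ↦ X i - c_i⁻¹ F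
kills F and changes every polynomial only by a multiple of F. -/
theorem exists_isRestriction {F : MvPolynomial (Fin 3) K} (hF : F.IsHomogeneous 1) (h0 : F ≠ 0) :
    ∃ φ y z, IsRestriction F φ y z := by
  obtain ⟨c, hc⟩ := linear_eq_sum hF
  obtain ⟨i, hi⟩ : ∃ i, c i ≠ 0 := by
    by_contra! h
    exact h0 (by rw [hc]; simp [h])
  obtain ⟨y, z, hyz, hyi, hzi⟩ : ∃ y z : Fin 3, y ≠ z ∧ y ≠ i ∧ z ≠ i := by
    clear hi; revert i; decide
  set g : Fin 3 → MvPolynomial (Fin 3) K :=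
    fun k => if k = i then X i - C (c i)⁻¹ * F else X k with hg
  have hgi : g i = X i - C (c i)⁻¹ * F := by simp [hg]
  have hgk : ∀ k, k ≠ i → g k = X k := fun k hk => by simp [hg, hk]
  have hF0 : aeval g F = 0 := by
    have h1 : aeval g F = ∑ k, C (c k) * g k := by
      conv_lhs => rw [hc]
      simp [map_sum, algebraMap_eq]
    have h2 : ∀ k, C (c k) * g k = C (c k) * X k - if k = i then F else 0 := by
      intro k
      rcases eq_or_ne k i with rfl | hk
      · rw [hgi, if_pos rfl, mul_sub, ← mul_assoc, ← C_mul, mul_inv_cancel₀ hi, C_1, one_mul]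
      · rw [hgk k hk, if_neg hk, sub_zero]
    rw [h1, Finset.sum_congr rfl fun k _ => h2 k, Finset.sum_sub_distrib, ← hc]
    simp
  have hdvd : ∀ f, F ∣ f - aeval g f := by
    have key : (Ideal.Quotient.mkₐ K (Ideal.span {F})).comp (aeval g) =
        Ideal.Quotient.mkₐ K (Ideal.span {F}) := by
      ext k
      simp only [AlgHom.comp_apply, aeval_X, Ideal.Quotient.mkₐ_eq_mk]
      rw [Ideal.Quotient.eq, Ideal.mem_span_singleton]
      rcases eq_or_ne k i with rfl | hk
      · rw [hgi]; exact ⟨-C (c k)⁻¹, by ring⟩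
      · rw [hgk k hk]; simp
    intro f
    have := DFunLike.congr_fun key f
    simp only [AlgHom.comp_apply, Ideal.Quotient.mkₐ_eq_mk] at this
    rw [← Ideal.mem_span_singleton, ← Ideal.Quotient.eq, this]
  refine ⟨aeval g, y, z, hyz, by simp [hgk y hyi], by simp [hgk z hzi],
    fun n f hf => algHom_map_forms (fun k => ?_) hf, fun f => ⟨fun h => ?_, ?_⟩⟩
  · rcases eq_or_ne k i with rfl | hk
    · rw [hgi]
      refine (isHomogeneous_X K k).sub ?_
      simpa using (isHomogeneous_C (Fin 3) (c k)⁻¹).mul hF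
    · rw [hgk k hk]; exact isHomogeneous_X K k
  · have := hdvd f
    rwa [h, sub_zero] at this
  · rintro ⟨q, rfl⟩
    rw [map_mul, hF0, zero_mul]

theorem IsRestriction.map_self {F : MvPolynomial (Fin 3) K} {φ y z} (h : IsRestriction F φ y z) :
    φ F = 0 := (h.eq_zero_iff F).2 dvd_rfl

/-- If the dimension did not grow, then zW ⊆ yW. Iterating, every power of y would divide every u in
W up to a power of z, hence divide u itself, which is impossible for u ≠ 0 by degree. -/
theorem finrank_add_one_le_finrank_sup {W : Submodule K (MvPolynomial (Fin 3) K)}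
    [Module.Finite K W] (hW : W ≠ ⊥) {y z : Fin 3} (hyz : y ≠ z) :
    Module.finrank K W + 1 ≤ Module.finrank K
      ((W.map (LinearMap.mulLeft K (X y)) ⊔ W.map (LinearMap.mulLeft K (X z)) :
        Submodule K (MvPolynomial (Fin 3) K))) := by
  set Y := W.map (LinearMap.mulLeft K (X y : MvPolynomial (Fin 3) K)) with hY
  set Z := W.map (LinearMap.mulLeft K (X z : MvPolynomial (Fin 3) K)) with hZ
  have hYf : Module.finrank K Y = Module.finrank K W := finrank_map_mul (X_ne_zero y) W
  rw [Nat.succ_le_iff, ← hYf]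
  refine Submodule.finrank_lt_finrank_of_lt (lt_of_le_of_ne le_sup_left fun heq => hW ?_)
  have hle : Z ≤ Y := heq ▸ le_sup_right
  have step : ∀ k : ℕ, ∀ u ∈ W, ∃ v ∈ W, X z ^ k * u = X y ^ k * v := by
    intro k
    induction k with
    | zero => exact fun u hu => ⟨u, hu, by simp⟩
    | succ k ih =>
      intro u hu
      obtain ⟨v, hv, h1⟩ := ih u hu
      obtain ⟨w, hw, h2⟩ := hle (Submodule.mem_map_of_mem hv)
      refine ⟨w, hw, ?_⟩
      simp only [LinearMap.mulLeft_apply] at h2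
      rw [pow_succ', mul_assoc, h1, mul_left_comm, ← h2]
      ring
  rw [eq_bot_iff]
  intro u hu
  rw [Submodule.mem_bot]
  by_contra hu0
  obtain ⟨v, -, hv⟩ := step (u.totalDegree + 1) u hu
  have hd : (X y : MvPolynomial (Fin 3) K) ^ (u.totalDegree + 1) ∣ u := by
    refine (MvPolynomial.X_prime (i := y) (R := K)).pow_dvd_of_dvd_mul_left _ ?_ ⟨v, hv⟩
    intro hdvd
    have := (MvPolynomial.X_prime (i := y) (R := K)).dvd_of_dvd_pow hdvd
    rw [X_dvd_X] at this
    exact hyz this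
  obtain ⟨q, hq⟩ := hd
  have hq0 : q ≠ 0 := by rintro rfl; simp at hq; exact hu0 hq
  have := congrArg totalDegree hq
  rw [totalDegree_mul_of_isDomain (pow_ne_zero _ (X_ne_zero y)) hq0, totalDegree_X_pow] at this
  omega

section Restriction

variable {F : MvPolynomial (Fin 3) K}
  {φ : MvPolynomial (Fin 3) K →ₐ[K] MvPolynomial (Fin 3) K} {y z : Fin 3}

/-- Rank-nullity for the restriction of I_n to the line: its kernel is F·(I : F)_{n-1}. -/
theorem finrank_eq_add_finrank_map (h : IsRestriction F φ y z) (hF : F.IsHomogeneous 1) (h0 : F ≠ 0)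
    (I : Ideal (MvPolynomial (Fin 3) K)) (n : ℤ) :
    hilbIdeal I n = hilbIdeal (I.colon {F}) (n - 1) +
      Module.finrank K ((piece I n).map φ.toLinearMap) := by
  have h1 := LinearMap.finrank_range_add_finrank_ker (φ.toLinearMap.domRestrict (piece I n))
  rw [LinearMap.range_domRestrict] at h1
  have h2 : (LinearMap.ker (φ.toLinearMap.domRestrict (piece I n))).map (piece I n).subtype =
      (piece (I.colon {F}) (n - 1)).map (LinearMap.mulLeft K F) := by
    ext f
    simp only [Submodule.mem_map, LinearMap.mem_ker, LinearMap.domRestrict_apply,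
      Submodule.subtype_apply, Subtype.exists, LinearMap.mulLeft_apply, AlgHom.toLinearMap_apply]
    constructor
    · rintro ⟨f, hf, hf0, rfl⟩
      obtain ⟨g, hg, rfl⟩ := exists_of_dvd_of_mem_forms (linear_mem_forms hF) hf.2
        ((h.eq_zero_iff f).1 hf0)
      refine ⟨g, ⟨Submodule.mem_colon_singleton.2 ?_, hg⟩, rfl⟩
      rw [smul_eq_mul, mul_comm]; exact hf.1
    · rintro ⟨g, hg, rfl⟩
      refine ⟨F * g, ⟨?_, ?_⟩, (h.eq_zero_iff _).2 (dvd_mul_right _ _), rfl⟩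
      · have := Submodule.mem_colon_singleton.1 hg.1
        rwa [smul_eq_mul, mul_comm] at this
      · simpa using mul_mem_forms (linear_mem_forms hF) hg.2
  have h3 := congrArg (fun V : Submodule K (MvPolynomial (Fin 3) K) => Module.finrank K V) h2
  simp only [finrank_map_mul h0, Submodule.finrank_map_subtype_eq] at h3
  rw [hilbIdeal, hilbIdeal, ← h1, h3, add_comm]

theorem finrank_map_forms (h : IsRestriction F φ y z) (hF : F.IsHomogeneous 1) (h0 : F ≠ 0)
    {n : ℤ} (hn : -1 ≤ n) :
    (Module.finrank K ((forms K n).map φ.toLinearMap) : ℤ) = n + 1 := by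
  have h1 := finrank_eq_add_finrank_map h hF h0 ⊤ n
  have h2 : (⊤ : Ideal (MvPolynomial (Fin 3) K)).colon {F} = ⊤ := by
    ext; simp
  rw [h2, hilbIdeal, hilbIdeal, piece_top, piece_top] at h1
  have := finrank_forms_sub_one (K := K) hn
  omega

theorem map_piece_sup (h : IsRestriction F φ y z) (hF : F.IsHomogeneous 1)
    {I : Ideal (MvPolynomial (Fin 3) K)} (hI : I.IsHomogeneous (forms K)) (n : ℤ) :
    (piece (I ⊔ Ideal.span {F}) n).map φ.toLinearMap = (piece I n).map φ.toLinearMap := by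
  refine le_antisymm ?_ (Submodule.map_mono fun f hf => ⟨Ideal.mem_sup_left hf.1, hf.2⟩)
  rintro _ ⟨f, ⟨hf, hfn⟩, rfl⟩
  obtain ⟨a, ha, b, hb, rfl⟩ := Submodule.mem_sup.1 hf
  refine ⟨(DirectSum.decompose (forms K) a n : MvPolynomial (Fin 3) K),
    ⟨hI n ha, SetLike.coe_mem _⟩, ?_⟩
  rw [Ideal.mem_span_singleton] at hb
  obtain ⟨c, rfl⟩ := hb
  have h1 := DirectSum.coe_decompose_mul_add_of_left_mem (forms K) (j := n - 1) (b := c)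
    (linear_mem_forms hF)
  rw [add_sub_cancel] at h1
  have h2 := DirectSum.decompose_of_mem_same (forms K) hfn
  rw [DirectSum.decompose_add, DirectSum.add_apply, Submodule.coe_add, h1] at h2
  rw [← h2]
  simp [h.map_self]

/-- The Hilbert function of a section by a line in terms of restrictions to the line. -/
theorem hilbQuot_sup (h : IsRestriction F φ y z) (hF : F.IsHomogeneous 1) (h0 : F ≠ 0)
    {I : Ideal (MvPolynomial (Fin 3) K)} (hI : I.IsHomogeneous (forms K)) {n : ℤ} (hn : -1 ≤ n) :
    (hilbQuot (I ⊔ Ideal.span {F}) n : ℤ) =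
      n + 1 - Module.finrank K ((piece I n).map φ.toLinearMap) := by
  have h1 := finrank_eq_add_finrank_map h hF h0 (I ⊔ Ideal.span {F}) n
  -- The section lies on the line, so its residual is empty.
  have h2 : (I ⊔ Ideal.span {F}).colon {F} = ⊤ := by
    refine Ideal.eq_top_iff_one _ |>.2 (Submodule.mem_colon_singleton.2 ?_)
    rw [one_smul]
    exact Ideal.mem_sup_right (Ideal.mem_span_singleton_self F)
  rw [h2, map_piece_sup h hF hI, hilbIdeal, hilbIdeal, piece_top] at h1
  have h3 := hilbQuot_add_hilbIdeal (I ⊔ Ideal.span {F}) n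
  rw [hilbIdeal] at h3
  have := finrank_forms_sub_one (K := K) hn
  omega

/-- Dimension count in the exact sequence 0 → R/(I : F)(-1) → R/I → R/(I + (F)) → 0. This is the
recursion on which the reduction by lines rests. -/
theorem hilbQuot_eq_add {F : MvPolynomial (Fin 3) K} (hF : F.IsHomogeneous 1) (h0 : F ≠ 0)
    {I : Ideal (MvPolynomial (Fin 3) K)} (hI : I.IsHomogeneous (forms K)) (n : ℤ) :
    hilbQuot I n = hilbQuot (I.colon {F}) (n - 1) + hilbQuot (I ⊔ Ideal.span {F}) n := by
  obtain ⟨φ, y, z, h⟩ := exists_isRestriction hF h0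
  rcases lt_or_ge n 0 with hn | hn
  · rw [hilbQuot_neg _ hn, hilbQuot_neg _ hn, hilbQuot_neg _ (by omega)]
  have h1 := finrank_eq_add_finrank_map h hF h0 I n
  have h2 := hilbQuot_sup h hF h0 hI (n := n) (by omega)
  have h3 := hilbQuot_add_hilbIdeal I n
  have h4 := hilbQuot_add_hilbIdeal (I.colon {F}) (n - 1)
  have := finrank_forms_sub_one (K := K) (n := n) (by omega)
  omega

/-- Multiplying a nonzero space of forms on a line by the linear forms raises its dimension. -/
theorem finrank_map_mul_forms_one (h : IsRestriction F φ y z)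
    {V : Submodule K (MvPolynomial (Fin 3) K)} {n : ℤ} (hV : V ≤ forms K n)
    (h0 : V.map φ.toLinearMap ≠ ⊥) :
    Module.finrank K (V.map φ.toLinearMap) + 1 ≤
      Module.finrank K ((V * forms K 1).map φ.toLinearMap) := by
  have hf := finite_of_le_forms hV
  have hVm : V * forms K 1 ≤ forms K (n + 1) :=
    Submodule.mul_le.2 fun a ha b hb => mul_mem_forms (hV ha) hb
  have hf' := finite_of_le_forms hVm
  refine (finrank_add_one_le_finrank_sup h0 h.ne).trans (Submodule.finrank_mono (sup_le ?_ ?_))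
  · rintro _ ⟨_, ⟨f, hf, rfl⟩, rfl⟩
    exact ⟨f * X y, Submodule.mul_mem_mul hf (X_mem_forms y), by simp [h.map_y, mul_comm]⟩
  · rintro _ ⟨_, ⟨f, hf, rfl⟩, rfl⟩
    exact ⟨f * X z, Submodule.mul_mem_mul hf (X_mem_forms z), by simp [h.map_z, mul_comm]⟩

theorem piece_mul_forms_le (I : Ideal (MvPolynomial (Fin 3) K)) (n : ℤ) :
    piece I n * forms K 1 ≤ piece I (n + 1) :=
  Submodule.mul_le.2 fun _ ha b hb => ⟨I.mul_mem_right b ha.1, mul_mem_forms ha.2 hb⟩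

theorem finrank_map_succ (h : IsRestriction F φ y z) (I : Ideal (MvPolynomial (Fin 3) K)) {n : ℤ}
    (h0 : (piece I n).map φ.toLinearMap ≠ ⊥) :
    Module.finrank K ((piece I n).map φ.toLinearMap) + 1 ≤
      Module.finrank K ((piece I (n + 1)).map φ.toLinearMap) :=
  (finrank_map_mul_forms_one h (piece_le_forms I n) h0).trans
    (Submodule.finrank_mono (Submodule.map_mono (piece_mul_forms_le I n)))

theorem map_piece_ne_bot_add (h : IsRestriction F φ y z) (I : Ideal (MvPolynomial (Fin 3) K))
    {n : ℤ} (h0 : (piece I n).map φ.toLinearMap ≠ ⊥) (k : ℕ) :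
    (piece I (n + k)).map φ.toLinearMap ≠ ⊥ ∧
    Module.finrank K ((piece I n).map φ.toLinearMap) + k ≤
      Module.finrank K ((piece I (n + k)).map φ.toLinearMap) := by
  induction k with
  | zero => rw [Nat.cast_zero, add_zero]; exact ⟨h0, le_rfl⟩
  | succ k ih =>
    have := finrank_map_succ h I ih.1
    have e : n + ((k + 1 : ℕ) : ℤ) = n + k + 1 := by push_cast; ring
    rw [e]
    refine ⟨fun hb => ?_, by omega⟩
    rw [hb, finrank_bot] at this
    omega

end Restriction

/-! ### Ideals of fat points -/

/-- A homogeneous ideal `I` such that the line `x = 0` avoids the scheme defined by `I`, and that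
is not contained in the ideal of a line. -/
structure IsPointsIdeal (x : MvPolynomial (Fin 3) K) (I : Ideal (MvPolynomial (Fin 3) K)) :
    Prop where
  isHomogeneous : I.IsHomogeneous (forms K)
  mem_of_mul_mem : ∀ f, x * f ∈ I → f ∈ I
  exists_not_dvd : ∀ F : MvPolynomial (Fin 3) K, F.IsHomogeneous 1 → F ≠ 0 →
    ∃ n : ℤ, ∃ f ∈ piece I n, ¬ F ∣ f

theorem mem_colon {I : Ideal (MvPolynomial (Fin 3) K)} {F f : MvPolynomial (Fin 3) K} :
    f ∈ I.colon {F} ↔ F * f ∈ I := by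
  rw [Submodule.mem_colon_singleton, smul_eq_mul, mul_comm]

theorem isHomogeneous_colon {I : Ideal (MvPolynomial (Fin 3) K)} (hI : I.IsHomogeneous (forms K))
    {a : ℤ} {F : MvPolynomial (Fin 3) K} (hF : F ∈ forms K a) :
    (Submodule.colon I {F}).IsHomogeneous (forms K) := by
  intro n f hf
  rw [mem_colon] at hf ⊢
  have := hI (a + n) hf
  rwa [DirectSum.coe_decompose_mul_add_of_left_mem (forms K) hF] at this

theorem IsPointsIdeal.colon {x : MvPolynomial (Fin 3) K} {I : Ideal (MvPolynomial (Fin 3) K)}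
    (hI : IsPointsIdeal x I) {F : MvPolynomial (Fin 3) K} (hF : F.IsHomogeneous 1) :
    IsPointsIdeal x (I.colon {F}) where
  isHomogeneous := isHomogeneous_colon hI.isHomogeneous (linear_mem_forms hF)
  mem_of_mul_mem f hf := by
    rw [mem_colon] at hf ⊢
    exact hI.mem_of_mul_mem _ (by rwa [mul_left_comm] at hf)
  exists_not_dvd G hG hG0 := by
    obtain ⟨n, f, hf, h⟩ := hI.exists_not_dvd G hG hG0
    exact ⟨n, f, ⟨mem_colon.2 (I.mul_mem_left F hf.1), hf.2⟩, h⟩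

theorem isHomogeneous_pow {I : Ideal (MvPolynomial (Fin 3) K)} (hI : I.IsHomogeneous (forms K))
    (m : ℕ) : (I ^ m).IsHomogeneous (forms K) := by
  induction m with
  | zero => rw [pow_zero, Ideal.one_eq_top]; exact Ideal.IsHomogeneous.top _
  | succ m ih => rw [pow_succ]; exact ih.mul hI

theorem isHomogeneous_pointIdeal (p : ℙ K (Fin 3 → K)) :
    (pointIdeal p).IsHomogeneous (forms K) := by
  refine Ideal.homogeneous_span _ _ ?_
  rintro f ⟨⟨n, hf⟩, -⟩
  exact ⟨n, mem_forms_of_isHomogeneous hf⟩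

theorem isHomogeneous_ideal (A : FatPointScheme K) : A.ideal.IsHomogeneous (forms K) :=
  Ideal.IsHomogeneous.iInf₂ fun p _ => isHomogeneous_pow (isHomogeneous_pointIdeal p) _

theorem aeval_mul_of_isHomogeneous {g : MvPolynomial (Fin 3) K} {n : ℕ} (hg : g.IsHomogeneous n)
    (q : Fin 3 → K) (u : MvPolynomial (Fin 3) K) :
    aeval (fun i => C (q i) * u) g = C (eval q g) * u ^ n := by
  rw [aeval_def, eval₂_eq', eval_eq', map_sum, Finset.sum_mul]
  refine Finset.sum_congr rfl fun d hd => ?_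
  have hdn : ∑ i, d i = n := by
    rw [← Finsupp.degree_eq_sum, Finsupp.degree_eq_weight_one]
    exact hg (mem_support_iff.1 hd)
  simp only [mul_pow, Finset.prod_mul_distrib, Finset.prod_pow_eq_pow_sum, hdn, algebraMap_eq,
    map_mul, map_prod, map_pow, mul_assoc]

/-- A linear form not vanishing at `p` is a nonzerodivisor modulo powers of the ideal of `p`. -/
theorem mem_pointIdeal_pow_of_mul_mem {p : ℙ K (Fin 3 → K)} {x : MvPolynomial (Fin 3) K}
    (hx : x.IsHomogeneous 1) (hxp : eval p.rep x ≠ 0) (m : ℕ) {f : MvPolynomial (Fin 3) K}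
    (hf : x * f ∈ pointIdeal p ^ m) : f ∈ pointIdeal p ^ m := by
  set c := eval p.rep x with hc
  set w : Fin 3 → MvPolynomial (Fin 3) K := fun i => X i - C (p.rep i * c⁻¹) * x with hw
  have hwp : ∀ i, w i ∈ pointIdeal p := by
    intro i
    refine Ideal.subset_span ⟨⟨1, (isHomogeneous_X K i).sub ?_⟩, ?_⟩
    · simpa using (isHomogeneous_C (Fin 3) (p.rep i * c⁻¹)).mul hx
    · simp only [hw, map_sub, eval_X, map_mul, eval_C, ← hc]
      field_simp
      ring
  -- the family `λ p + s w`, with `X = λ p + w`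
  set θ : MvPolynomial (Fin 3) K →ₐ[K] Polynomial (MvPolynomial (Fin 3) K) :=
    aeval fun i => Polynomial.C (C (p.rep i * c⁻¹) * x) + Polynomial.X * Polynomial.C (w i) with hθ
  have hone : ∀ g, (θ g).eval 1 = g := by
    have : ((Polynomial.aeval (1 : MvPolynomial (Fin 3) K)).restrictScalars K).comp θ =
        AlgHom.id K _ := by
      ext i
      simp [hθ, hw]
    intro g
    simpa using DFunLike.congr_fun this g
  -- The coefficient of sⁱ in θ g lies in the i-th power of the ideal of p, because each w i lies in
  -- that ideal.
  have hrees : ∀ g, θ g ∈ reesAlgebra (pointIdeal p) := by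
    intro g
    induction g using MvPolynomial.induction_on with
    | C a =>
      have : θ (C a) = algebraMap _ _ (C a : MvPolynomial (Fin 3) K) := by
        rw [← algebraMap_eq, AlgHom.commutes]; rfl
      rw [this]
      exact Subalgebra.algebraMap_mem _ _
    | add a b ha hb => rw [map_add]; exact add_mem ha hb
    | mul_X a i ha =>
      rw [map_mul]
      refine mul_mem ha ?_
      simp only [hθ, aeval_X]
      refine add_mem (Subalgebra.algebraMap_mem (reesAlgebra (pointIdeal p)) _) ?_
      rw [mul_comm, Polynomial.C_mul_X_eq_monomial]
      exact reesAlgebra.monomial_mem.2 (by simpa using hwp i)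
  -- At s = 0 a form becomes a multiple of xⁿ, with coefficient zero exactly when the form vanishes
  -- at p. So s divides θ g on the ideal of p, and does not divide θ x.
  have hzero : ∀ g (n : ℕ), g.IsHomogeneous n →
      (θ g).eval 0 = C (eval p.rep g * (c⁻¹) ^ n) * x ^ n := by
    intro g n hg
    have h1 : ∀ g, (θ g).eval 0 = aeval (fun i => C (p.rep i) * (C c⁻¹ * x)) g := by
      have : ((Polynomial.aeval (0 : MvPolynomial (Fin 3) K)).restrictScalars K).comp θ =
          aeval (fun i => C (p.rep i) * (C c⁻¹ * x)) := by
        ext i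
        simp [hθ, mul_assoc]
      intro g
      simpa using DFunLike.congr_fun this g
    rw [h1, aeval_mul_of_isHomogeneous hg, mul_pow, ← C_pow, ← mul_assoc, ← C_mul]
  have hdvd : ∀ g ∈ pointIdeal p, Polynomial.X ∣ θ g := by
    intro g hg
    have hle : pointIdeal p ≤ (Ideal.span {Polynomial.X}).comap θ := by
      refine Ideal.span_le.2 ?_
      rintro g ⟨⟨n, hn⟩, hgp⟩
      rw [SetLike.mem_coe, Ideal.mem_comap, Ideal.mem_span_singleton, Polynomial.X_dvd_iff,
        Polynomial.coeff_zero_eq_eval_zero, hzero g n hn, hgp]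
      simp
    exact Ideal.mem_span_singleton.1 (hle hg)
  have hpow : ∀ g ∈ pointIdeal p ^ m, Polynomial.X ^ m ∣ θ g := by
    intro g hg
    have hle : pointIdeal p ≤ (Ideal.span {Polynomial.X}).comap θ :=
      fun g hg => Ideal.mem_span_singleton.2 (hdvd g hg)
    have := (Ideal.pow_right_mono hle m).trans (Ideal.le_comap_pow _ m) hg
    rwa [Ideal.mem_comap, Ideal.span_singleton_pow, Ideal.mem_span_singleton] at this
  have h1 := hpow _ hf
  rw [map_mul] at h1
  have h2 : Polynomial.X ^ m ∣ θ f := by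
    refine Polynomial.prime_X.pow_dvd_of_dvd_mul_left _ ?_ h1
    rw [Polynomial.X_dvd_iff, Polynomial.coeff_zero_eq_eval_zero, hzero x 1 hx, ← hc, pow_one,
      pow_one, mul_inv_cancel₀ hxp, C_1, one_mul]
    rintro rfl
    simp [hc] at hxp
  -- At s = 1 the polynomial f is the sum of the coefficients of θ f; only those of index at least m
  -- occur, and these lie in the m-th power.
  rw [← hone f, Polynomial.eval_eq_sum, Polynomial.sum_def]
  refine Ideal.sum_mem _ fun i hi => ?_
  rw [one_pow, mul_one]
  have him : m ≤ i := by
    by_contra hlt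
    exact Polynomial.mem_support_iff.1 hi (Polynomial.X_pow_dvd_iff.1 h2 i (by omega))
  exact Ideal.pow_le_pow_right him ((mem_reesAlgebra_iff _ _).1 (hrees f) i)

/-- Look for l among the combinations of the two variables fixed by the restriction to F = 0: there
a nonzero form cannot be divisible by F. -/
theorem exists_linear_mem_pointIdeal {F : MvPolynomial (Fin 3) K} (hF : F.IsHomogeneous 1)
    (h0 : F ≠ 0) (p : ℙ K (Fin 3 → K)) :
    ∃ l : MvPolynomial (Fin 3) K, l.IsHomogeneous 1 ∧ l ∈ pointIdeal p ∧ ¬ F ∣ l := by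
  obtain ⟨φ, y, z, h⟩ := exists_isRestriction hF h0
  by_cases hp : p.rep y = 0
  · refine ⟨X y, isHomogeneous_X K y, Ideal.subset_span ⟨⟨1, isHomogeneous_X K y⟩, by simpa⟩, ?_⟩
    rw [← h.eq_zero_iff, h.map_y]
    exact X_ne_zero y
  · have hl : (C (p.rep z) * X y - C (p.rep y) * X z : MvPolynomial (Fin 3) K).IsHomogeneous 1 := by
      refine IsHomogeneous.sub ?_ ?_
      · simpa using (isHomogeneous_C (Fin 3) (p.rep z)).mul (isHomogeneous_X K y)
      · simpa using (isHomogeneous_C (Fin 3) (p.rep y)).mul (isHomogeneous_X K z)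
    refine ⟨_, hl, Ideal.subset_span ⟨⟨1, hl⟩, by simp [mul_comm]⟩, ?_⟩
    rw [← h.eq_zero_iff, map_sub, map_mul, map_mul, h.map_y, h.map_z]
    intro heq
    have := congrArg (coeff (Finsupp.single z 1)) heq
    have hne : ¬ Finsupp.single y 1 = Finsupp.single z (1 : ℕ) := fun e =>
      h.ne (Finsupp.single_left_injective one_ne_zero e)
    simp [coeff_C_mul, coeff_X, algHom_C, hne, hp] at this

/-- The coefficient vector v of x only has to avoid the zeros of finitely many nonzero linear forms
∑ pᵢ Xᵢ, which is possible over an infinite field. The extra factor `X 0` ensures x ≠ 0 even for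
empty support. -/
theorem exists_linear_eval_ne_zero [IsAlgClosed K] (A : FatPointScheme K) :
    ∃ x : MvPolynomial (Fin 3) K, x.IsHomogeneous 1 ∧ x ≠ 0 ∧
      ∀ p ∈ A.support, eval p.rep x ≠ 0 := by
  have hinf : Infinite K := inferInstance
  set P : MvPolynomial (Fin 3) K := X 0 * ∏ p ∈ A.support, ∑ i, C (p.rep i) * X i with hP
  have hP0 : P ≠ 0 := by
    refine mul_ne_zero (X_ne_zero 0) (Finset.prod_ne_zero_iff.2 fun p _ h => ?_)
    refine p.rep_nonzero (funext fun i => ?_)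
    have := congrArg (coeff (Finsupp.single i 1)) h
    simpa [coeff_sum, coeff_C_mul, coeff_X, Finsupp.single_left_inj] using this
  obtain ⟨v, hv⟩ : ∃ v, eval v P ≠ 0 := by
    by_contra! h
    exact hP0 (MvPolynomial.funext fun v => by rw [h v, map_zero])
  rw [hP, map_mul, map_prod] at hv
  have hx : (∑ i, C (v i) * X i : MvPolynomial (Fin 3) K).IsHomogeneous 1 :=
    IsHomogeneous.sum _ _ _ fun i _ => by
      simpa using (isHomogeneous_C (Fin 3) (v i)).mul (isHomogeneous_X K i)
  refine ⟨_, hx, ?_, fun p hp => ?_⟩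
  · intro h
    have := congrArg (coeff (Finsupp.single 0 1)) h
    simp [coeff_sum, coeff_C_mul, coeff_X, Finsupp.single_left_inj] at this
    simp [this] at hv
  · have := Finset.prod_ne_zero_iff.1 (right_ne_zero_of_mul hv) p hp
    simpa [mul_comm] using this

theorem exists_isPointsIdeal [IsAlgClosed K] (A : FatPointScheme K) :
    ∃ x : MvPolynomial (Fin 3) K, x.IsHomogeneous 1 ∧ x ≠ 0 ∧ IsPointsIdeal x A.ideal := by
  obtain ⟨x, hx, hx0, hxp⟩ := exists_linear_eval_ne_zero A
  refine ⟨x, hx, hx0, isHomogeneous_ideal A, fun f hf => ?_, fun F hF hF0 => ?_⟩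
  · simp only [FatPointScheme.ideal, Ideal.mem_iInf] at hf ⊢
    exact fun p hp => mem_pointIdeal_pow_of_mul_mem hx (hxp p hp) _ (hf p hp)
  -- A product of powers of lines through the points, none of them the line F = 0, lies in the ideal
  -- and does not vanish on that line.
  · choose l hl hlp hlF using exists_linear_mem_pointIdeal hF hF0
    refine ⟨_, ∏ p ∈ A.support, l p ^ A p, ⟨?_, mem_forms_of_isHomogeneous
      (IsHomogeneous.prod _ _ _ fun p _ => (hl p).pow (A p))⟩, ?_⟩
    · rw [SetLike.mem_coe, Submodule.restrictScalars_mem, FatPointScheme.ideal]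
      simp only [Ideal.mem_iInf]
      intro p hp
      exact Ideal.mem_of_dvd _ (Finset.dvd_prod_of_mem _ hp) (Ideal.pow_mem_pow (hlp p) _)
    · obtain ⟨φ, y, z, h⟩ := exists_isRestriction hF hF0
      rw [← h.eq_zero_iff, map_prod]
      refine Finset.prod_ne_zero_iff.2 fun p _ => ?_
      rw [map_pow]
      exact pow_ne_zero _ fun h' => hlF p ((h.eq_zero_iff _).1 h')

/-! ### Hilbert functions of residuals -/

section Hilbert

variable {x F : MvPolynomial (Fin 3) K} {I : Ideal (MvPolynomial (Fin 3) K)}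
  {φ : MvPolynomial (Fin 3) K →ₐ[K] MvPolynomial (Fin 3) K} {y z : Fin 3}

theorem IsPointsIdeal.colon_self (hI : IsPointsIdeal x I) : I.colon {x} = I := by
  ext f
  rw [mem_colon]
  exact ⟨hI.mem_of_mul_mem f, I.mul_mem_left x⟩

theorem IsPointsIdeal.hilbQuot_eq (hI : IsPointsIdeal x I) (hx : x.IsHomogeneous 1) (hx0 : x ≠ 0)
    (n : ℤ) : hilbQuot I n = hilbQuot I (n - 1) + hilbQuot (I ⊔ Ideal.span {x}) n := by
  conv_lhs => rw [hilbQuot_eq_add hx hx0 hI.isHomogeneous, hI.colon_self]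

theorem IsPointsIdeal.hilbQuot_le_add (hI : IsPointsIdeal x I) (hx : x.IsHomogeneous 1)
    (hx0 : x ≠ 0) (n : ℤ) (k : ℕ) : hilbQuot I n ≤ hilbQuot I (n + k) := by
  induction k with
  | zero => simp
  | succ k ih =>
    have := hI.hilbQuot_eq hx hx0 (n + (k + 1 : ℕ))
    rw [show n + ((k + 1 : ℕ) : ℤ) - 1 = n + k by push_cast; ring] at this
    omega

theorem IsPointsIdeal.hilbQuot_le_of_eventually (hI : IsPointsIdeal x I) (hx : x.IsHomogeneous 1)
    (hx0 : x ≠ 0) {D : ℕ} (hD : ∀ᶠ n : ℕ in atTop, hilbQuot I n = D) (n : ℤ) :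
    hilbQuot I n ≤ D := by
  obtain ⟨N, hN⟩ := eventually_atTop.1 hD
  have h := hI.hilbQuot_le_add hx hx0 n ((N + n.natAbs : ℤ) - n).toNat
  rw [show n + (((N + n.natAbs : ℤ) - n).toNat : ℤ) = ((N + n.natAbs : ℕ) : ℤ) by omega,
    hN _ (by omega)] at h
  exact h

theorem neg_one_le_of_map_piece_ne_bot {n : ℤ} (h0 : (piece I n).map φ.toLinearMap ≠ ⊥) :
    -1 ≤ n := by
  by_contra hn
  refine h0 ?_
  rw [show piece I n = ⊥ from eq_bot_iff.2 ((piece_le_forms I n).trans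
    (forms_of_neg (K := K) (n := n) (by omega)).le), Submodule.map_bot]

/-- The value is n + 1 minus the dimension of the restriction of I_n, and a nonzero restriction
gains at least one dimension per degree. -/
theorem hilbQuot_sup_add_le (h : IsRestriction F φ y z) (hF : F.IsHomogeneous 1) (hF0 : F ≠ 0)
    (hI : I.IsHomogeneous (forms K)) {n : ℤ} (h0 : (piece I n).map φ.toLinearMap ≠ ⊥) (k : ℕ) :
    hilbQuot (I ⊔ Ideal.span {F}) (n + k) ≤ hilbQuot (I ⊔ Ideal.span {F}) n := by
  have hn := neg_one_le_of_map_piece_ne_bot h0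
  have h1 := (map_piece_ne_bot_add h I h0 k).2
  have h2 := hilbQuot_sup h hF hF0 hI (n := n) hn
  have h3 := hilbQuot_sup h hF hF0 hI (n := n + k) (by omega)
  omega

/-- From the first degree with nonzero restriction this is a nonincreasing sequence of natural
numbers, so it stabilises. This makes the infimum in `degree` the actual eventual value. -/
theorem IsPointsIdeal.eventually_hilbQuot_sup (hI : IsPointsIdeal x I) (hF : F.IsHomogeneous 1)
    (hF0 : F ≠ 0) : ∀ᶠ n : ℕ in atTop,
      hilbQuot (I ⊔ Ideal.span {F}) n = degree (I ⊔ Ideal.span {F}) := by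
  obtain ⟨φ, y, z, h⟩ := exists_isRestriction hF hF0
  obtain ⟨n, f, hf, hFf⟩ := hI.exists_not_dvd F hF hF0
  have h0 : (piece I n).map φ.toLinearMap ≠ ⊥ := fun hb => hFf <| (h.eq_zero_iff f).1 <|
    (Submodule.mem_bot K).1 (hb ▸ Submodule.mem_map_of_mem hf)
  set a : ℕ → ℕ := fun k => hilbQuot (I ⊔ Ideal.span {F}) (n + k) with ha
  obtain ⟨k₀, hk₀⟩ := Nat.sInf_mem (Set.range_nonempty a)
  have key : ∀ᶠ m : ℕ in atTop, hilbQuot (I ⊔ Ideal.span {F}) m = sInf (Set.range a) := by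
    refine eventually_atTop.2 ⟨(n + k₀).natAbs, fun m hm => le_antisymm ?_ ?_⟩
    · have h1 := hilbQuot_sup_add_le h hF hF0 hI.isHomogeneous
        (map_piece_ne_bot_add h I h0 k₀).1 (m - (n + k₀)).toNat
      rw [show n + (k₀ : ℤ) + ((m - (n + k₀)).toNat : ℤ) = m by omega] at h1
      exact h1.trans hk₀.le
    · refine Nat.sInf_le ⟨(m - n).toNat, ?_⟩
      simp only [ha]
      rw [show n + ((m - n).toNat : ℤ) = m by omega]
  rw [degree_eq key]
  exact key

/-- Either I_n restricts to zero and the value is n + 1, or the values decrease weakly from n on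
towards the degree. -/
theorem IsPointsIdeal.degree_sup_le (hI : IsPointsIdeal x I) (hF : F.IsHomogeneous 1)
    (hF0 : F ≠ 0) {n : ℤ} (hn : (degree (I ⊔ Ideal.span {F}) : ℤ) ≤ n + 1) :
    degree (I ⊔ Ideal.span {F}) ≤ hilbQuot (I ⊔ Ideal.span {F}) n := by
  obtain ⟨φ, y, z, h⟩ := exists_isRestriction hF hF0
  by_cases h0 : (piece I n).map φ.toLinearMap = ⊥
  · have h2 := hilbQuot_sup h hF hF0 hI.isHomogeneous (n := n) (by omega)
    rw [h0, finrank_bot] at h2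
    omega
  · obtain ⟨N, hN⟩ := eventually_atTop.1 (hI.eventually_hilbQuot_sup hF hF0)
    have h1 := hilbQuot_sup_add_le h hF hF0 hI.isHomogeneous h0 ((N + n.natAbs : ℤ) - n).toNat
    rw [show n + (((N + n.natAbs : ℤ) - n).toNat : ℤ) = ((N + n.natAbs : ℕ) : ℤ) by omega,
      hN _ (by omega)] at h1
    exact h1

/-- The hypothesis says that the line is not a fixed component of I_n. Then the restriction has
dimension at least 1, so the section has value at most n in degree n, and this value bounds its
degree. -/
theorem IsPointsIdeal.degree_sup_le_of_ne (hI : IsPointsIdeal x I) (hF : F.IsHomogeneous 1)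
    (hF0 : F ≠ 0) {n : ℤ} (hn : hilbIdeal (I.colon {F}) (n - 1) ≠ hilbIdeal I n) :
    (degree (I ⊔ Ideal.span {F}) : ℤ) ≤ n := by
  obtain ⟨φ, y, z, h⟩ := exists_isRestriction hF hF0
  have h1 := finrank_eq_add_finrank_map h hF hF0 I n
  have h0 : (piece I n).map φ.toLinearMap ≠ ⊥ := by
    intro hb
    rw [hb, finrank_bot] at h1
    omega
  have h2 := hilbQuot_sup h hF hF0 hI.isHomogeneous (neg_one_le_of_map_piece_ne_bot h0)
  by_contra hlt
  obtain ⟨N, hN⟩ := eventually_atTop.1 (hI.eventually_hilbQuot_sup hF hF0)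
  have h3 := hilbQuot_sup_add_le h hF hF0 hI.isHomogeneous h0 ((N + n.natAbs : ℤ) - n).toNat
  rw [show n + (((N + n.natAbs : ℤ) - n).toNat : ℤ) = ((N + n.natAbs : ℕ) : ℤ) by omega,
    hN _ (by omega)] at h3
  omega

theorem IsPointsIdeal.eventually_hilbQuot (hI : IsPointsIdeal x I) (hF : F.IsHomogeneous 1)
    (hF0 : F ≠ 0) {D : ℕ} (hD : ∀ᶠ n : ℕ in atTop, hilbQuot (I.colon {F}) n = D) :
    ∀ᶠ n : ℕ in atTop, hilbQuot I n = D + degree (I ⊔ Ideal.span {F}) := by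
  filter_upwards [hI.eventually_hilbQuot_sup hF hF0, (tendsto_sub_atTop_nat 1).eventually hD,
    eventually_ge_atTop 1] with n h1 h2 h3
  rw [hilbQuot_eq_add hF hF0 hI.isHomogeneous, h1, show (n : ℤ) - 1 = ((n - 1 : ℕ) : ℤ) by omega,
    h2]

end Hilbert

/-! ### The sequence of residuals and the GMS condition -/

section Residual

variable {x : MvPolynomial (Fin 3) K} {A : FatPointScheme K} {r : ℕ}
  {F : Fin r → MvPolynomial (Fin 3) K}

theorem residualIdeal_zero (A : FatPointScheme K) (F : Fin r → MvPolynomial (Fin 3) K) :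
    residualIdeal A F 0 = A.ideal := rfl

theorem residualIdeal_succ (A : FatPointScheme K) (F : Fin r → MvPolynomial (Fin 3) K)
    (i : Fin r) : residualIdeal A F i.succ = (residualIdeal A F i.castSucc).colon {F i} :=
  Fin.induction_succ _ _ _

theorem isPointsIdeal_residualIdeal (hA : IsPointsIdeal x A.ideal)
    (hF : ∀ i, (F i).IsHomogeneous 1) (i : Fin (r + 1)) :
    IsPointsIdeal x (residualIdeal A F i) := by
  induction i using Fin.induction with
  | zero => exact hA
  | succ i ih => rw [residualIdeal_succ]; exact ih.colon (hF i)

/-- The Hilbert function of a residual reaches the degree as soon as the remaining entries of the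
reduction vector allow. -/
theorem exists_degree_residualIdeal (hA : IsPointsIdeal x A.ideal)
    (hF : ∀ i, (F i).IsHomogeneous 1) (hF0 : ∀ i, F i ≠ 0) (hred : TotallyReduces A F)
    (i : Fin (r + 1)) : ∃ D : ℕ, (∀ᶠ n : ℕ in atTop, hilbQuot (residualIdeal A F i) n = D) ∧
      ∀ n : ℤ, (∀ k : Fin r, (i : ℕ) ≤ k →
        reductionVector A F k ≤ n - ((k : ℕ) - (i : ℕ)) + 1) →
      D ≤ hilbQuot (residualIdeal A F i) n := by
  induction i using Fin.reverseInduction with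
  | last => exact ⟨0, by rw [hred]; simp [hilbQuot_top], fun _ _ => Nat.zero_le _⟩
  | cast i ih =>
    obtain ⟨D, h1, h2⟩ := ih
    have hi := isPointsIdeal_residualIdeal hA hF i.castSucc
    rw [residualIdeal_succ] at h1 h2
    refine ⟨_, hi.eventually_hilbQuot (hF i) (hF0 i) h1, fun n hn => ?_⟩
    rw [hilbQuot_eq_add (hF i) (hF0 i) hi.isHomogeneous]
    -- Each residual lowers the degree by one, so d_k is compared with the degree n - (k - i) in
    -- which its section is counted.
    refine Nat.add_le_add (h2 _ fun k hk => ?_) (hi.degree_sup_le (hF i) (hF0 i) ?_)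
    · have := hn k (by simp only [Fin.val_succ, Fin.val_castSucc] at hk ⊢; omega)
      simp only [Fin.val_succ, Fin.val_castSucc] at this ⊢
      push_cast
      omega
    · simpa [reductionVector] using hn i (by simp)

/-- If the next entry d_i is at most t, then GMS gives d_k ≤ t - (k - i) + 1 for later k, exactly
what `exists_degree_residualIdeal` needs. The opposite inequality holds since the Hilbert function
is nondecreasing. -/
theorem hilbQuot_residualIdeal_eq (hA : IsPointsIdeal x A.ideal) (hx : x.IsHomogeneous 1)
    (hx0 : x ≠ 0) (hF : ∀ i, (F i).IsHomogeneous 1) (hF0 : ∀ i, F i ≠ 0)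
    (hred : TotallyReduces A F) (hGMS : IsGMS (reductionVector A F)) {j : Fin (r + 1)} {t : ℤ}
    (hj : ∀ k : Fin r, k.castSucc = j → reductionVector A F k ≤ t) :
    ∃ D : ℕ, ∀ n : ℤ, t ≤ n → hilbQuot (residualIdeal A F j) n = D := by
  obtain ⟨D, h1, h2⟩ := exists_degree_residualIdeal hA hF hF0 hred j
  refine ⟨D, fun n hn => le_antisymm ((isPointsIdeal_residualIdeal hA hF j).hilbQuot_le_of_eventually
    hx hx0 h1 n) (h2 n fun k hk => ?_)⟩
  induction j using Fin.lastCases with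
  | last => simp only [Fin.val_last] at hk; omega
  | cast i =>
    have hi := hj i rfl
    simp only [Fin.val_castSucc] at hk ⊢
    rcases hk.eq_or_lt with he | hlt
    · have : i = k := Fin.ext he
      subst this
      omega
    · have := hGMS.2.2 i k hlt
      omega

theorem product_mul_mem (A : FatPointScheme K) (F : Fin r → MvPolynomial (Fin 3) K)
    (hF : ∀ i, (F i).IsHomogeneous 1) (hF0 : ∀ i, F i ≠ 0) (j : Fin (r + 1)) :
    ∃ G ∈ forms K (j : ℕ), G ≠ 0 ∧ ∀ f ∈ residualIdeal A F j, G * f ∈ A.ideal := by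
  induction j using Fin.induction with
  | zero => exact ⟨1, isWeightedHomogeneous_one K _, one_ne_zero, fun f hf => by
      simpa [residualIdeal_zero] using hf⟩
  | succ i ih =>
    obtain ⟨G, hG, hG0, h⟩ := ih
    refine ⟨G * F i, ?_, mul_ne_zero hG0 (hF0 i), fun f hf => ?_⟩
    · simpa using mul_mem_forms hG (linear_mem_forms (hF i))
    · rw [residualIdeal_succ, mem_colon] at hf
      rw [mul_assoc]
      exact h _ hf

end Residual

/-! ### Bounds for the number of generators -/

section Generators

variable {x : MvPolynomial (Fin 3) K} {I : Ideal (MvPolynomial (Fin 3) K)}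
  {φ : MvPolynomial (Fin 3) K →ₐ[K] MvPolynomial (Fin 3) K} {y z : Fin 3}

/-- In the least degree n with I_n ≠ 0 the kernel x·I_{n-1} of the restriction is zero; from there
on nonzero restrictions persist. -/
theorem IsPointsIdeal.map_piece_ne_bot (hI : IsPointsIdeal x I) (hx : x.IsHomogeneous 1)
    (hx0 : x ≠ 0) (h : IsRestriction x φ y z) {t : ℕ} (ht : piece I (t : ℤ) ≠ ⊥) :
    (piece I (t : ℤ)).map φ.toLinearMap ≠ ⊥ := by
  classical
  have hex : ∃ n : ℕ, piece I (n : ℤ) ≠ ⊥ := ⟨t, ht⟩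
  set n := Nat.find hex with hn
  have hnt : n ≤ t := Nat.find_min' hex ht
  have hprev : hilbIdeal I ((n : ℤ) - 1) = 0 := by
    suffices piece I ((n : ℤ) - 1) = ⊥ by rw [hilbIdeal, this, finrank_bot]
    rcases Nat.eq_zero_or_pos n with h0 | h0
    · rw [h0]
      exact eq_bot_iff.2 ((piece_le_forms _ _).trans (forms_of_neg (by norm_num)).le)
    · have := Nat.find_min hex (m := n - 1) (by omega)
      rw [show (n : ℤ) - 1 = ((n - 1 : ℕ) : ℤ) by omega]
      exact not_not.1 this
  have h0 : (piece I (n : ℤ)).map φ.toLinearMap ≠ ⊥ := by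
    intro hb
    have h1 := finrank_eq_add_finrank_map h hx hx0 I n
    rw [hI.colon_self, hprev, hb, finrank_bot] at h1
    exact Nat.find_spec hex (Submodule.finrank_eq_zero.1 h1)
  have := (map_piece_ne_bot_add h I h0 (t - n)).1
  rwa [show (n : ℤ) + ((t - n : ℕ) : ℤ) = t by omega] at this

theorem finite_piece_mul_forms (I : Ideal (MvPolynomial (Fin 3) K)) (n : ℤ) :
    Module.Finite K (piece I n * forms K 1 : Submodule K (MvPolynomial (Fin 3) K)) :=
  finite_of_le_forms ((piece_mul_forms_le I n).trans (piece_le_forms I _))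

theorem add_finrank_map_le_finrank_mul (hx : x.IsHomogeneous 1) (hx0 : x ≠ 0)
    (h : IsRestriction x φ y z) (I : Ideal (MvPolynomial (Fin 3) K)) (n : ℤ) :
    hilbIdeal I n +
      Module.finrank K ((piece I n * forms K 1).map φ.toLinearMap) ≤
      Module.finrank K (piece I n * forms K 1 : Submodule K (MvPolynomial (Fin 3) K)) := by
  have hfin := finite_piece_mul_forms I n
  have h1 := LinearMap.finrank_range_add_finrank_ker
    (φ.toLinearMap.domRestrict (piece I n * forms K 1))
  rw [LinearMap.range_domRestrict] at h1
  -- The kernel of the restriction on I_n R_1 contains x·I_n.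
  have h2 : (piece I n).map (LinearMap.mulLeft K x) ≤
      (LinearMap.ker (φ.toLinearMap.domRestrict (piece I n * forms K 1))).map
        (piece I n * forms K 1).subtype := by
    rintro _ ⟨f, hf, rfl⟩
    refine ⟨⟨x * f, ?_⟩, ?_, rfl⟩
    · rw [mul_comm x f]; exact Submodule.mul_mem_mul hf (linear_mem_forms hx)
    · exact (h.eq_zero_iff _).2 (dvd_mul_right x f)
  have h3 := Submodule.finrank_mono h2
  rw [finrank_map_mul hx0, Submodule.finrank_map_subtype_eq] at h3
  rw [hilbIdeal]
  omega

theorem mul_forms_one_le (V : Submodule K (MvPolynomial (Fin 3) K)) :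
    V * forms K 1 ≤ V.map (LinearMap.mulLeft K (X 0)) ⊔ V.map (LinearMap.mulLeft K (X 1)) ⊔
      V.map (LinearMap.mulLeft K (X 2)) := by
  refine Submodule.mul_le.2 fun f hf l hl => ?_
  rw [forms_one_eq] at hl
  obtain ⟨c, rfl⟩ := linear_eq_sum hl
  have key : ∀ i, f * (C (c i) * X i) ∈ V.map (LinearMap.mulLeft K (X i)) := fun i =>
    ⟨c i • f, V.smul_mem _ hf, by rw [LinearMap.mulLeft_apply, smul_eq_C_mul]; ring⟩
  rw [Fin.sum_univ_three, mul_add, mul_add]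
  exact add_mem (Submodule.mem_sup_left (add_mem (Submodule.mem_sup_left (key 0))
    (Submodule.mem_sup_right (key 1)))) (Submodule.mem_sup_right (key 2))

theorem mul_mul_mem_map {n : ℤ} (i : Fin 3) {u f : MvPolynomial (Fin 3) K} (hu : u ∈ forms K 1)
    (hf : f ∈ piece I (n - 1)) : X i * (u * f) ∈ (piece I n).map (LinearMap.mulLeft K (X i)) :=
  ⟨u * f, ⟨I.mul_mem_left u hf.1, by simpa using mul_mem_forms hu hf.2⟩, rfl⟩

/-- The Koszul relations bound the dimension of `I_n R_1`. -/
theorem finrank_mul_forms_one_le (I : Ideal (MvPolynomial (Fin 3) K)) (n : ℤ) :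
    Module.finrank K (piece I n * forms K 1 : Submodule K (MvPolynomial (Fin 3) K)) +
      2 * hilbIdeal I (n - 1) ≤ 3 * hilbIdeal I n := by
  set V : Fin 3 → Submodule K (MvPolynomial (Fin 3) K) :=
    fun i => (piece I n).map (LinearMap.mulLeft K (X i)) with hV
  have hfin : ∀ i, Module.Finite K (V i) := fun i => inferInstanceAs (Module.Finite K
    ((piece I n).map (LinearMap.mulLeft K (X i : MvPolynomial (Fin 3) K))))
  have hr : ∀ i, Module.finrank K (V i) = hilbIdeal I n := fun i => finrank_map_mul (X_ne_zero i) _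
  have h1 := Submodule.finrank_sup_add_finrank_inf_eq (V 0) (V 1)
  have h2 := Submodule.finrank_sup_add_finrank_inf_eq (V 0 ⊔ V 1) (V 2)
  -- X₀(X₁f) = X₁(X₀f) with f in I_{n-1}; the next overlap uses X₀(X₂f) = X₂(X₀f). These two
  -- suffice.
  have h3 : hilbIdeal I (n - 1) ≤ Module.finrank K (V 0 ⊓ V 1 : Submodule K _) := by
    rw [hilbIdeal, ← finrank_map_mul (mul_ne_zero (X_ne_zero 0) (X_ne_zero 1)) (piece I (n - 1))]
    refine Submodule.finrank_mono ?_
    rintro _ ⟨f, hf, rfl⟩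
    refine ⟨?_, ?_⟩
    · rw [LinearMap.mulLeft_apply, mul_assoc]
      exact mul_mul_mem_map 0 (X_mem_forms 1) hf
    · rw [LinearMap.mulLeft_apply, mul_assoc, mul_left_comm]
      exact mul_mul_mem_map 1 (X_mem_forms 0) hf
  have h4 : hilbIdeal I (n - 1) ≤ Module.finrank K ((V 0 ⊔ V 1) ⊓ V 2 : Submodule K _) := by
    rw [hilbIdeal, ← finrank_map_mul (mul_ne_zero (X_ne_zero 0) (X_ne_zero 2)) (piece I (n - 1))]
    refine Submodule.finrank_mono ?_
    rintro _ ⟨f, hf, rfl⟩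
    refine ⟨Submodule.mem_sup_left ?_, ?_⟩
    · rw [LinearMap.mulLeft_apply, mul_assoc]
      exact mul_mul_mem_map 0 (X_mem_forms 2) hf
    · rw [LinearMap.mulLeft_apply, mul_assoc, mul_left_comm]
      exact mul_mul_mem_map 2 (X_mem_forms 0) hf
  have h5 : Module.finrank K (piece I n * forms K 1 : Submodule K _) ≤
      Module.finrank K (V 0 ⊔ V 1 ⊔ V 2 : Submodule K _) :=
    Submodule.finrank_mono (mul_forms_one_le _)
  rw [hr, hr] at h1
  rw [hr] at h2
  omega

/-- With e the difference at t, constancy of the Hilbert function gives h_I(t+1) = h_I(t) + t + 2,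
while h_I(t) - h_I(t-1) = t + 1 - e. The restriction bound dim I_t R_1 ≥ h_I(t) + (t + 1 - e) + 1
and the Koszul bound dim I_t R_1 ≤ 3h_I(t) - 2h_I(t-1) yield the two estimates. -/
theorem IsPointsIdeal.generators_bounds (hI : IsPointsIdeal x I) (hx : x.IsHomogeneous 1)
    (hx0 : x ≠ 0) {t D : ℕ} (hD : ∀ n : ℤ, t ≤ n → hilbQuot I n = D)
    (ht : piece I (t : ℤ) ≠ ⊥) :
    (Module.finrank K (piece I (t : ℤ) * forms K 1 : Submodule K (MvPolynomial (Fin 3) K)) : ℤ) +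
      max (2 * deltaHilbQuot I t - t) 0 ≤ hilbIdeal I (t + 1) ∧
    (hilbIdeal I (t + 1) : ℤ) ≤
      Module.finrank K (piece I (t : ℤ) * forms K 1 : Submodule K (MvPolynomial (Fin 3) K)) +
        deltaHilbQuot I t := by
  obtain ⟨φ, y, z, h⟩ := exists_isRestriction hx hx0
  have h1 := hilbQuot_add_hilbIdeal I t
  have h2 := hilbQuot_add_hilbIdeal I (t + 1)
  have h3 := hilbQuot_add_hilbIdeal I (t - 1)
  have h4 := finrank_forms_sub_one (K := K) (n := t) (by omega)
  have h5 := finrank_forms_sub_one (K := K) (n := t + 1) (by omega)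
  rw [add_sub_cancel_right] at h5
  have h6 := finrank_mul_forms_one_le I t
  have h7 := finrank_map_mul_forms_one h (piece_le_forms I t)
    (hI.map_piece_ne_bot hx hx0 h ht)
  have h8 := add_finrank_map_le_finrank_mul hx hx0 h I t
  have h9 := hilbQuot_sup h hx hx0 hI.isHomogeneous (n := t) (by omega)
  have h10 := hI.hilbQuot_eq hx hx0 t
  have h11 : Module.finrank K (piece I (t : ℤ) * forms K 1 : Submodule K _) ≤
      hilbIdeal I (t + 1) := Submodule.finrank_mono (piece_mul_forms_le I t)
  rw [hD _ (by omega)] at h1 h2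
  have h12 := hD t le_rfl
  rw [deltaHilbQuot]
  omega

theorem nuSucc_add (I : Ideal (MvPolynomial (Fin 3) K)) (t : ℕ) :
    nuSucc I t + Module.finrank K (piece I (t : ℤ) * forms K 1 : Submodule K _) =
      hilbIdeal I (t + 1) :=
  finrank_quotient_submoduleOf (piece_mul_forms_le I t)

/-- If `G J_{n-a} = I_n` for dimension reasons then multiplication by linear forms has images of
the same dimension. -/
theorem finrank_mul_forms_one_eq {I J : Ideal (MvPolynomial (Fin 3) K)}
    {G : MvPolynomial (Fin 3) K} {a n : ℤ} (hG : G ∈ forms K a) (hG0 : G ≠ 0)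
    (h : ∀ f ∈ J, G * f ∈ I) (heq : hilbIdeal J (n - a) = hilbIdeal I n) :
    Module.finrank K (piece I n * forms K 1 : Submodule K (MvPolynomial (Fin 3) K)) =
      Module.finrank K (piece J (n - a) * forms K 1 : Submodule K (MvPolynomial (Fin 3) K)) := by
  have h1 : (piece J (n - a)).map (LinearMap.mulLeft K G) = piece I n := by
    refine Submodule.eq_of_le_of_finrank_eq ?_ ?_
    · rintro _ ⟨f, hf, rfl⟩
      exact ⟨h f hf.1, by simpa using mul_mem_forms hG hf.2⟩
    · rw [finrank_map_mul hG0]; exact heq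
  have h2 : (piece J (n - a) * forms K 1).map (LinearMap.mulLeft K G) = piece I n * forms K 1 := by
    rw [← h1]
    refine le_antisymm (Submodule.map_le_iff_le_comap.2 (Submodule.mul_le.2 fun f hf l hl => ?_))
      (Submodule.mul_le.2 ?_)
    · rw [Submodule.mem_comap, LinearMap.mulLeft_apply, ← mul_assoc]
      exact Submodule.mul_mem_mul (Submodule.mem_map_of_mem hf) hl
    · rintro _ ⟨f, hf, rfl⟩ l hl
      exact ⟨f * l, Submodule.mul_mem_mul hf hl, by simp [mul_assoc]⟩
  rw [← h2, finrank_map_mul hG0]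

theorem piece_ne_bot_of_initialDegree_le (hI : IsPointsIdeal x I) {t : ℕ}
    (ht : initialDegree I ≤ t) : piece I (t : ℤ) ≠ ⊥ := by
  obtain ⟨n, f, hf, hXf⟩ := hI.exists_not_dvd (X 0) (isHomogeneous_X K 0) (X_ne_zero 0)
  have hf0 : f ≠ 0 := by rintro rfl; exact hXf (dvd_zero _)
  obtain ⟨k, rfl, -⟩ := exists_nat_of_mem_forms hf.2 hf0
  -- The infimum of an empty set would be 0, so nonemptiness is needed before the least degree
  -- carries any information.
  have hne : {t : ℕ | piece I (t : ℤ) ≠ ⊥}.Nonempty :=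
    ⟨k, fun hb => hf0 ((Submodule.mem_bot K).1 (hb ▸ hf))⟩
  obtain ⟨g, hg, hg0⟩ := Submodule.exists_mem_ne_zero_of_ne_bot (Nat.sInf_mem hne)
  intro hb
  have hmem : X 0 ^ (t - initialDegree I) * g ∈ piece I (t : ℤ) := by
    refine ⟨I.mul_mem_left _ hg.1, ?_⟩
    have := mul_mem_forms (pow_mem_forms (X_mem_forms (K := K) 0) (t - initialDegree I)) hg.2
    rwa [mul_one, show ((t - initialDegree I : ℕ) : ℤ) + ((sInf {t : ℕ | piece I (t : ℤ) ≠ ⊥} : ℕ) : ℤ)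
      = t by change _ + ((initialDegree I : ℕ) : ℤ) = t; omega] at this
  rw [hb, Submodule.mem_bot] at hmem
  exact mul_ne_zero (pow_ne_zero _ (X_ne_zero 0)) hg0 hmem

end Generators

/-! ### First cohomology -/

section Cech

/-- The inclusion of the polynomial ring in its field of fractions. -/
abbrev toFrac : MvPolynomial (Fin 3) K →+* FractionRing (MvPolynomial (Fin 3) K) :=
  algebraMap _ _

theorem toFrac_injective : Function.Injective (toFrac (K := K)) :=
  IsFractionRing.injective _ _

theorem toFrac_ne_zero {u : MvPolynomial (Fin 3) K} (hu : u ≠ 0) : toFrac u ≠ 0 :=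
  (map_ne_zero_iff _ toFrac_injective).2 hu

theorem prod_X_ne_zero (s : Finset (Fin 3)) : (∏ i ∈ s, (X i : MvPolynomial (Fin 3) K)) ≠ 0 :=
  Finset.prod_ne_zero_iff.2 fun i _ => X_ne_zero i

theorem prod_X_mem_forms (s : Finset (Fin 3)) :
    (∏ i ∈ s, (X i : MvPolynomial (Fin 3) K)) ∈ forms K s.card := by
  refine mem_forms_of_isHomogeneous ?_
  simpa using IsHomogeneous.prod s (fun i => (X i : MvPolynomial (Fin 3) K)) (fun _ => 1)
    fun i _ => isHomogeneous_X K i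

theorem prod_pow_mem_forms (s : Finset (Fin 3)) (N : ℕ) :
    (∏ i ∈ s, (X i : MvPolynomial (Fin 3) K)) ^ N ∈ forms K (N * s.card) :=
  pow_mem_forms (prod_X_mem_forms s) N

variable {I : Ideal (MvPolynomial (Fin 3) K)} {m : ℤ} {s : Finset (Fin 3)}
  {f : FractionRing (MvPolynomial (Fin 3) K)} {x : MvPolynomial (Fin 3) K}

theorem mem_sections : f ∈ sections I m s ↔ ∃ N : ℕ, ∃ g ∈ piece I (m + N * s.card),
    f * toFrac ((∏ i ∈ s, X i) ^ N) = toFrac g := by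
  have h0 : ∀ N : ℕ, toFrac ((∏ i ∈ s, (X i : MvPolynomial (Fin 3) K)) ^ N) ≠ 0 := fun N =>
    toFrac_ne_zero (pow_ne_zero _ (prod_X_ne_zero s))
  refine exists_congr fun N => exists_congr fun g => and_congr_right fun _ => ?_
  exact eq_div_iff (h0 N)

theorem mul_mem_piece {n a : ℤ} {g u : MvPolynomial (Fin 3) K} (hg : g ∈ piece I n)
    (hu : u ∈ forms K a) : g * u ∈ piece I (n + a) :=
  ⟨I.mul_mem_right u hg.1, mul_mem_forms hg.2 hu⟩

theorem eventually_mem_sections (h : f ∈ sections I m s) :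
    ∀ᶠ N : ℕ in atTop, ∃ g ∈ piece I (m + N * s.card),
      f * toFrac ((∏ i ∈ s, X i) ^ N) = toFrac g := by
  obtain ⟨N, g, hg, hfg⟩ := mem_sections.1 h
  refine eventually_atTop.2 ⟨N, fun M hM => ⟨g * (∏ i ∈ s, X i) ^ (M - N), ?_, ?_⟩⟩
  · have := mul_mem_piece hg (prod_pow_mem_forms s (M - N))
    rwa [show m + (N : ℤ) * s.card + ((M - N : ℕ) : ℤ) * s.card = m + M * s.card by
      rw [Nat.cast_sub hM]; ring] at this
  · rw [map_mul, ← hfg, mul_assoc, ← map_mul, ← pow_add, Nat.add_sub_cancel' hM]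

/-- A fraction belongs to `sections` if its denominator divides a power of the product of the
variables. -/
theorem mem_sections_of_dvd {u g : MvPolynomial (Fin 3) K} {d : ℤ} {N : ℕ}
    (hu : u ∈ forms K d) (hdvd : u ∣ (∏ i ∈ s, X i) ^ N) (hg : g ∈ piece I (m + d))
    (hfg : f * toFrac u = toFrac g) : f ∈ sections I m s := by
  obtain ⟨v, hv, heq⟩ := exists_of_dvd_of_mem_forms hu (prod_pow_mem_forms s N) hdvd
  refine mem_sections.2 ⟨N, g * v, ?_, ?_⟩
  · have := mul_mem_piece hg hv
    rwa [show m + d + (N * s.card - d) = m + N * s.card by ring] at this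
  · rw [heq, map_mul, map_mul, ← hfg, mul_assoc]

theorem sections_mono_left {J : Ideal (MvPolynomial (Fin 3) K)} (h : I ≤ J) :
    sections I m s ≤ sections J m s := by
  intro f hf
  obtain ⟨N, g, hg, hfg⟩ := mem_sections.1 hf
  exact mem_sections.2 ⟨N, g, ⟨h hg.1, hg.2⟩, hfg⟩

theorem sections_mono_right {s' : Finset (Fin 3)} (h : s ⊆ s') :
    sections I m s ≤ sections I m s' := by
  intro f hf
  obtain ⟨N, g, hg, hfg⟩ := mem_sections.1 hf
  exact mem_sections_of_dvd (prod_pow_mem_forms s N)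
    (pow_dvd_pow_of_dvd (Finset.prod_dvd_prod_of_subset _ _ _ h) N) hg hfg

theorem mem_sections_singleton {i : Fin 3} {N : ℕ} {g : MvPolynomial (Fin 3) K}
    (hg : g ∈ piece I (m + N)) (hfg : f * toFrac (X i ^ N) = toFrac g) :
    f ∈ sections I m {i} :=
  mem_sections.2 ⟨N, g, by simpa using hg, by simpa using hfg⟩

theorem eventually_of_mem_singleton {i : Fin 3} (h : f ∈ sections I m {i}) :
    ∀ᶠ N : ℕ in atTop, ∃ g ∈ piece I (m + N), f * toFrac (X i ^ N) = toFrac g := by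
  simpa using eventually_mem_sections h

theorem eventually_of_mem_pair {i j : Fin 3} (h : f ∈ sections I m {i, j}) :
    ∀ᶠ N : ℕ in atTop, ∃ g ∈ piece I (m + N * 2), f * toFrac ((X i * X j) ^ N) = toFrac g := by
  rcases eq_or_ne i j with rfl | hij
  · rw [Finset.pair_eq_singleton] at h
    filter_upwards [(tendsto_id.nsmul_atTop (two_pos)).eventually (eventually_of_mem_singleton h)]
      with N hN
    obtain ⟨g, hg, hfg⟩ := hN
    refine ⟨g, ?_, ?_⟩
    · simpa [mul_comm] using hg
    · rw [← hfg, ← pow_two, ← pow_mul]; simp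
  · simpa [Finset.card_pair hij, Finset.prod_pair hij] using eventually_mem_sections h

theorem toFrac_mul_mem_sections {a : ℤ} {u : MvPolynomial (Fin 3) K} (hu : u ∈ forms K a)
    (hf : f ∈ sections I m s) : toFrac u * f ∈ sections I (m + a) s := by
  obtain ⟨N, g, hg, hfg⟩ := mem_sections.1 hf
  refine mem_sections.2 ⟨N, g * u, ?_, ?_⟩
  · have := mul_mem_piece hg hu
    rwa [add_right_comm] at this
  · rw [mul_assoc, hfg, map_mul, mul_comm]

theorem toFrac_mem_sections {u : MvPolynomial (Fin 3) K} (hu : u ∈ piece I m) :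
    toFrac u ∈ sections I m s :=
  mem_sections.2 ⟨0, u, by simpa using hu, by simp⟩

/-- Cancellation of x modulo I passes to the charts once both fractions are written with a common
exponent. -/
theorem IsPointsIdeal.mem_sections_of_mul (hI : IsPointsIdeal x I)
    (hf : f ∈ sections ⊤ m s) (hxf : toFrac x * f ∈ sections I (m + 1) s) :
    f ∈ sections I m s := by
  obtain ⟨N, ⟨g, hg, h1⟩, ⟨g', hg', h2⟩⟩ :=
    ((eventually_mem_sections hf).and (eventually_mem_sections hxf)).exists
  refine mem_sections.2 ⟨N, g, ⟨hI.mem_of_mul_mem g ?_, hg.2⟩, h1⟩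
  have : x * g = g' := toFrac_injective (by rw [map_mul, ← h1, ← h2, mul_assoc])
  rw [this]
  exact hg'.1

theorem X_pow_dvd_of_mul_eq {i j : Fin 3} (hij : i ≠ j) {N M : ℕ} {a b : MvPolynomial (Fin 3) K}
    (h : a * X j ^ M = b * X i ^ N) : X i ^ N ∣ a := by
  refine (MvPolynomial.X_prime (i := i) (R := K)).pow_dvd_of_dvd_mul_right _ ?_
    (Dvd.intro_left b h.symm)
  intro hdvd
  have := (MvPolynomial.X_prime (i := i) (R := K)).dvd_of_dvd_pow hdvd
  rw [X_dvd_X] at this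
  exact hij this

theorem X_pow_mem_forms (i : Fin 3) (N : ℕ) : (X i : MvPolynomial (Fin 3) K) ^ N ∈ forms K N := by
  simpa using pow_mem_forms (X_mem_forms (K := K) i) N

/-- Global sections of O(m) are forms: comparing the charts 0 and 1 already shows that the
denominator X₀ᴺ divides the numerator. -/
theorem exists_form_of_mem_sections (hf : ∀ i, f ∈ sections ⊤ m {i}) :
    ∃ c ∈ forms K m, f = toFrac c := by
  obtain ⟨N, ⟨a, ha, h1⟩, ⟨b, hb, h2⟩⟩ := ((eventually_of_mem_singleton (hf 0)).and
    (eventually_of_mem_singleton (hf 1))).exists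
  have h3 : a * X 1 ^ N = b * X 0 ^ N := toFrac_injective (by
    rw [map_mul, map_mul, ← h1, ← h2]; ring)
  obtain ⟨c, hc, rfl⟩ := exists_of_dvd_of_mem_forms (X_pow_mem_forms 0 N) ha.2
    (X_pow_dvd_of_mul_eq (by decide) h3)
  rw [add_sub_cancel_right] at hc
  refine ⟨c, hc, mul_right_cancel₀ (toFrac_ne_zero (pow_ne_zero N (X_ne_zero (0 : Fin 3)))) ?_⟩
  rw [h1, ← map_mul, mul_comm]

/-- A power of a linear form is a combination of powers of the variables. -/
theorem exists_pow_eq_sum (hx : x.IsHomogeneous 1) (N : ℕ) :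
    ∃ M : ℕ, ∃ u : Fin 3 → MvPolynomial (Fin 3) K,
      (∀ i, u i ∈ forms K (M - N)) ∧ x ^ M = ∑ i, u i * X i ^ N := by
  set J : Ideal (MvPolynomial (Fin 3) K) := Ideal.span (Set.range fun i => X i ^ N) with hJ
  have hX : ∀ i, (X i : MvPolynomial (Fin 3) K) ∈ J.radical := fun i =>
    ⟨N, Ideal.subset_span ⟨i, rfl⟩⟩
  obtain ⟨c, hc⟩ := linear_eq_sum hx
  obtain ⟨M, hM⟩ : x ∈ J.radical := by
    rw [hc]
    exact Ideal.sum_mem _ fun i _ => Ideal.mul_mem_left _ _ (hX i)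
  obtain ⟨u, hu⟩ := (Ideal.mem_span_range_iff_exists_fun).1 hM
  refine ⟨M, fun i => (DirectSum.decompose (forms K) (u i) (M - N) : MvPolynomial (Fin 3) K),
    fun i => SetLike.coe_mem _, ?_⟩
  have h1 : x ^ M ∈ forms K M := by
    simpa using pow_mem_forms (linear_mem_forms hx) M
  conv_lhs => rw [← DirectSum.decompose_of_mem_same (forms K) h1, ← hu, DirectSum.decompose_sum,
    DFinsupp.finsetSum_apply, AddSubmonoidClass.coe_finsetSum]
  refine Finset.sum_congr rfl fun i _ => ?_
  have h2 := DirectSum.coe_decompose_mul_add_of_right_mem (forms K) (i := (M : ℤ) - N) (a := u i)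
    (X_pow_mem_forms i N)
  rw [sub_add_cancel] at h2
  exact h2

theorem IsPointsIdeal.pow_mul_mem (hI : IsPointsIdeal x I) (N : ℕ) {g : MvPolynomial (Fin 3) K}
    (h : x ^ N * g ∈ I) : g ∈ I := by
  induction N with
  | zero => simpa using h
  | succ N ih => exact ih (hI.mem_of_mul_mem _ (by rwa [pow_succ', mul_assoc] at h))

/-- I is saturated: if every Xᵢᴺ h lies in I then so does x^M h for large M, and x can be cancelled.
-/
theorem IsPointsIdeal.mem_of_mem_sections (hI : IsPointsIdeal x I) (hx : x.IsHomogeneous 1)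
    {h : MvPolynomial (Fin 3) K} (hs : ∀ i, toFrac h ∈ sections I m {i}) : h ∈ I := by
  obtain ⟨N, hN⟩ := (eventually_all.2 fun i => eventually_of_mem_singleton (hs i)).exists
  obtain ⟨M, u, -, hM⟩ := exists_pow_eq_sum hx N
  refine hI.pow_mul_mem M ?_
  rw [hM, Finset.sum_mul]
  refine Ideal.sum_mem _ fun i _ => ?_
  obtain ⟨g, hg, heq⟩ := hN i
  rw [← map_mul] at heq
  rw [mul_assoc, mul_comm (X i ^ N), toFrac_injective heq]
  exact I.mul_mem_left _ hg.1

/-- X₂ is a nonzerodivisor modulo the monomial ideal (X₀ᴺ, X₁ᴺ): membership is tested on monomials,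
and multiplication by X₂ᴺ does not change the exponents of X₀ and X₁. -/
theorem mem_span_pow_of_mul_mem {N : ℕ} {a b c : MvPolynomial (Fin 3) K}
    (h : a * X 2 ^ N + b * X 0 ^ N = c * X 1 ^ N) :
    a ∈ Ideal.span {X 0 ^ N, X 1 ^ N} := by
  have hspan : Ideal.span {(X 0 : MvPolynomial (Fin 3) K) ^ N, X 1 ^ N} =
      Ideal.span ((fun s => monomial s (1 : K)) ''
        {Finsupp.single 0 N, Finsupp.single 1 N}) := by
    rw [Set.image_pair, X_pow_eq_monomial, X_pow_eq_monomial]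
  have h1 : a * X 2 ^ N ∈ Ideal.span {(X 0 : MvPolynomial (Fin 3) K) ^ N, X 1 ^ N} := by
    rw [show a * X 2 ^ N = (-b) * X 0 ^ N + c * X 1 ^ N by rw [← h]; ring]
    exact Ideal.mem_span_pair.2 ⟨_, _, rfl⟩
  rw [hspan, mem_ideal_span_monomial_image] at h1 ⊢
  intro d hd
  have hd' : d + Finsupp.single 2 N ∈ (a * X 2 ^ N).support := by
    rw [mem_support_iff, X_pow_eq_monomial, coeff_mul_monomial, mul_one]
    exact mem_support_iff.1 hd
  obtain ⟨s, hs, hle⟩ := h1 _ hd'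
  refine ⟨s, hs, ?_⟩
  rcases hs with rfl | rfl
  · rw [Finsupp.single_le_iff] at hle ⊢
    simpa using hle
  · rw [Finsupp.single_le_iff] at hle ⊢
    simpa using hle

theorem exists_forms_of_mem_span_pow {N : ℕ} {n : ℤ} {a : MvPolynomial (Fin 3) K}
    (ha : a ∈ forms K n) (h : a ∈ Ideal.span {X 0 ^ N, X 1 ^ N}) :
    ∃ p ∈ forms K (n - N), ∃ q ∈ forms K (n - N), a = p * X 0 ^ N + q * X 1 ^ N := by
  obtain ⟨p, q, rfl⟩ := Ideal.mem_span_pair.1 h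
  refine ⟨_, SetLike.coe_mem (DirectSum.decompose (forms K) p (n - N)), _,
    SetLike.coe_mem (DirectSum.decompose (forms K) q (n - N)), ?_⟩
  have h1 := DirectSum.coe_decompose_mul_add_of_right_mem (forms K) (i := n - N) (a := p)
    (X_pow_mem_forms 0 N)
  have h2 := DirectSum.coe_decompose_mul_add_of_right_mem (forms K) (i := n - N) (a := q)
    (X_pow_mem_forms 1 N)
  rw [sub_add_cancel] at h1 h2
  rw [← h1, ← h2, ← Submodule.coe_add, ← DirectSum.add_apply, ← DirectSum.decompose_add,
    DirectSum.decompose_of_mem_same (forms K) ha]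

/-- The first cohomology of the structure sheaf vanishes in all twists. -/
theorem exists_cochain {f : Fin 3 → Fin 3 → FractionRing (MvPolynomial (Fin 3) K)}
    (hf : ∀ i j, f i j ∈ sections ⊤ m {i, j}) (hcoc : ∀ i j k, f i j + f j k = f i k) :
    ∃ g : Fin 3 → FractionRing (MvPolynomial (Fin 3) K), (∀ i, g i ∈ sections ⊤ m {i}) ∧
      ∀ i j, f i j = g j - g i := by
  obtain ⟨N, ⟨a, ha, h1⟩, ⟨b, hb, h2⟩, ⟨c, hc, h3⟩⟩ := ((eventually_of_mem_pair (hf 0 1)).and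
    ((eventually_of_mem_pair (hf 1 2)).and (eventually_of_mem_pair (hf 0 2)))).exists
  have hX : ∀ i : Fin 3, toFrac (X i ^ N : MvPolynomial (Fin 3) K) ≠ 0 := fun i =>
    toFrac_ne_zero (pow_ne_zero N (X_ne_zero i))
  simp only [mul_pow, map_mul] at h1 h2 h3
  -- The cocycle identity cleared of denominators; it splits f 0 1 into a part over chart 1 and a
  -- part over chart 0.
  have h4 : a * X 2 ^ N + b * X 0 ^ N = c * X 1 ^ N := toFrac_injective (by
    rw [map_add, map_mul, map_mul, map_mul, ← h1, ← h2, ← h3, ← hcoc 0 1 2]; ring)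
  obtain ⟨p, hp, q, hq, rfl⟩ := exists_forms_of_mem_span_pow ha.2 (mem_span_pow_of_mul_mem h4)
  rw [show m + (N : ℤ) * 2 - N = m + N by ring] at hp hq
  have h5 : f 0 1 = toFrac p / toFrac (X 1 ^ N) + toFrac q / toFrac (X 0 ^ N) := by
    have := hX 0
    have := hX 1
    rw [map_add, map_mul, map_mul] at h1
    field_simp
    linear_combination h1
  set g : Fin 3 → FractionRing (MvPolynomial (Fin 3) K) :=
    ![- (toFrac q / toFrac (X 0 ^ N)), toFrac p / toFrac (X 1 ^ N),
      f 0 2 - toFrac q / toFrac (X 0 ^ N)] with hg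
  -- The component g 2 is (c - qX₂ᴺ)/(X₀X₂)ᴺ; this divisibility removes X₀ from its denominator.
  have hdvd : X 0 ^ N ∣ c - q * X 2 ^ N := by
    refine X_pow_dvd_of_mul_eq (j := 1) (M := N) (b := b + p * X 2 ^ N) (by decide) ?_
    rw [sub_mul, ← h4]; ring
  obtain ⟨v, hv, hveq⟩ := exists_of_dvd_of_mem_forms (n := m + N * 2) (X_pow_mem_forms 0 N)
    (Submodule.sub_mem _ hc.2 (by
      have := mul_mem_forms hq (X_pow_mem_forms 2 N)
      rwa [show m + (N : ℤ) + N = m + N * 2 by ring] at this)) hdvd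
  rw [show m + (N : ℤ) * 2 - N = m + N by ring] at hv
  have hgm : ∀ i, g i ∈ sections ⊤ m {i} := by
    have g0 : g 0 ∈ sections ⊤ m {0} := by
      refine Submodule.neg_mem _ (mem_sections_singleton (N := N) (g := q) (by rwa [piece_top]) ?_)
      exact div_mul_cancel₀ _ (hX 0)
    have g1 : g 1 ∈ sections ⊤ m {1} :=
      mem_sections_singleton (N := N) (g := p) (by rwa [piece_top]) (div_mul_cancel₀ _ (hX 1))
    have g2 : g 2 ∈ sections ⊤ m {2} := by
      refine mem_sections_singleton (N := N) (g := v) (by rwa [piece_top]) ?_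
      refine mul_left_cancel₀ (hX 0) ?_
      rw [← map_mul, ← hveq, map_sub, ← h3, map_mul]
      change _ * ((f 0 2 - toFrac q / toFrac (X 0 ^ N)) * _) = _
      have := hX 0
      field_simp
    intro i
    fin_cases i
    exacts [g0, g1, g2]
  have hg0 : ∀ j, f 0 j = g j - g 0 := by
    have e0 : f 0 0 = g 0 - g 0 := by
      rw [sub_self]
      simpa using hcoc 0 0 0
    have e1 : f 0 1 = g 1 - g 0 := by
      rw [h5]; simp [hg]
    have e2 : f 0 2 = g 2 - g 0 := by simp [hg]
    intro j
    fin_cases j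
    exacts [e0, e1, e2]
  refine ⟨g, hgm, fun i j => ?_⟩
  rw [← add_right_inj (f 0 i), hcoc, hg0, hg0]
  ring

end Cech

/-! ### Comparison of H¹ with the section by the line x = 0 -/

section CechDimension

variable {I : Ideal (MvPolynomial (Fin 3) K)} {m : ℤ} {x : MvPolynomial (Fin 3) K}

/-- Global sections of the structure sheaf of the scheme defined by `I` extend to forms, after
multiplication by a power of a linear form. -/
theorem exists_form_sub_mem_sections (hx : x.IsHomogeneous 1)
    {g : Fin 3 → FractionRing (MvPolynomial (Fin 3) K)} (hg : ∀ i, g i ∈ sections ⊤ m {i})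
    (hgI : ∀ i j, g j - g i ∈ sections I m {i, j}) :
    ∃ M : ℕ, ∃ H ∈ forms K (m + M), ∀ i,
      toFrac H - toFrac (x ^ M) * g i ∈ sections I (m + M) {i} := by
  obtain ⟨N, hN, hN'⟩ := ((eventually_all.2 fun i => eventually_of_mem_singleton (hg i)).and
    (eventually_all.2 fun i => eventually_all.2 fun j => eventually_of_mem_pair (hgI i j))).exists
  choose h hh hgh using hN
  have key : ∀ i j, X i ^ N * h j - X j ^ N * h i ∈ I := by
    intro i j
    obtain ⟨a, ha, hfa⟩ := hN' i j
    have : X i ^ N * h j - X j ^ N * h i = a := toFrac_injective (by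
      rw [map_sub, map_mul, map_mul, ← hgh, ← hgh, ← hfa, mul_pow, map_mul]; ring)
    rw [this]
    exact ha.1
  obtain ⟨M, u, hu, hM⟩ := exists_pow_eq_sum hx N
  have hH : ∀ j, u j * h j ∈ forms K (m + M) := fun j => by
    have := mul_mem_forms (hu j) (hh j).2
    rwa [show (M : ℤ) - N + (m + N) = m + M by ring] at this
  -- With x^M = ∑ uⱼXⱼᴺ and gⱼ = hⱼ/Xⱼᴺ, the form H = ∑ uⱼhⱼ glues the local data: Xᵢᴺ(H - x^M gᵢ) =
  -- ∑ uⱼ(Xᵢᴺhⱼ - Xⱼᴺhᵢ) lies in I.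
  refine ⟨M, ∑ j, u j * h j, Submodule.sum_mem _ fun j _ => hH j, fun i => ?_⟩
  refine mem_sections_singleton (N := N) (g := ∑ j, u j * (X i ^ N * h j - X j ^ N * h i)) ⟨?_, ?_⟩ ?_
  · exact Ideal.sum_mem _ fun j _ => I.mul_mem_left _ (key i j)
  · refine Submodule.sum_mem _ fun j _ => ?_
    have h1 := mul_mem_forms (hu j) (Submodule.sub_mem _
      (mul_mem_forms (X_pow_mem_forms i N) (hh j).2) (mul_mem_forms (X_pow_mem_forms j N) (hh i).2))
    rwa [show (M : ℤ) - N + (N + (m + N)) = m + M + N by ring] at h1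
  · rw [sub_mul, mul_assoc, hgh, ← map_mul, ← map_mul, ← map_sub, hM, Finset.sum_mul,
      Finset.sum_mul, ← Finset.sum_sub_distrib]
    exact congrArg _ (Finset.sum_congr rfl fun j _ => by ring)

theorem mem_piece_sup_iff (hI : I.IsHomogeneous (forms K)) (hx : x.IsHomogeneous 1) {n : ℤ}
    {h : MvPolynomial (Fin 3) K} : h ∈ piece (I ⊔ Ideal.span {x}) n ↔
      ∃ a ∈ piece I n, ∃ c ∈ forms K (n - 1), h = a + x * c := by
  constructor
  · rintro ⟨hh, hn⟩
    obtain ⟨a, ha, b, hb, rfl⟩ := Submodule.mem_sup.1 hh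
    obtain ⟨c, rfl⟩ := Ideal.mem_span_singleton.1 hb
    refine ⟨_, ⟨hI n ha, SetLike.coe_mem _⟩, _,
      SetLike.coe_mem (DirectSum.decompose (forms K) c (n - 1)), ?_⟩
    have h1 := DirectSum.coe_decompose_mul_add_of_left_mem (forms K) (j := n - 1) (b := c)
      (linear_mem_forms hx)
    rw [add_sub_cancel] at h1
    rw [← h1, ← Submodule.coe_add, ← DirectSum.add_apply, ← DirectSum.decompose_add,
      DirectSum.decompose_of_mem_same (forms K) hn]
  · rintro ⟨a, ha, c, hc, rfl⟩
    refine ⟨add_mem (Ideal.mem_sup_left ha.1) (Ideal.mem_sup_right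
      (Ideal.mem_span_singleton.2 (dvd_mul_right x c))), add_mem ha.2 ?_⟩
    simpa using mul_mem_forms (linear_mem_forms hx) hc

theorem exists_of_hilbQuot_sup_eq_zero (hI : I.IsHomogeneous (forms K)) (hx : x.IsHomogeneous 1)
    {n : ℤ} (h0 : hilbQuot (I ⊔ Ideal.span {x}) n = 0) {h : MvPolynomial (Fin 3) K}
    (hh : h ∈ forms K n) : ∃ a ∈ piece I n, ∃ c ∈ forms K (n - 1), h = a + x * c := by
  rw [← mem_piece_sup_iff hI hx]
  have h1 := hilbQuot_add_hilbIdeal (I ⊔ Ideal.span {x}) n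
  rw [h0, zero_add] at h1
  rwa [Submodule.eq_of_le_of_finrank_eq (piece_le_forms _ n) h1]

/-- Pairs of a cochain `g` and a form `h` of degree `m + 1` such that `h = x g` on the scheme
defined by `I`. -/
def liftedForms (I : Ideal (MvPolynomial (Fin 3) K)) (m : ℤ) (x : MvPolynomial (Fin 3) K) :
    Submodule K ((Fin 3 → FractionRing (MvPolynomial (Fin 3) K)) × MvPolynomial (Fin 3) K) where
  carrier := {q | (∀ i, q.1 i ∈ sections ⊤ m {i}) ∧ q.2 ∈ forms K (m + 1) ∧
    ∀ i, toFrac q.2 - toFrac x * q.1 i ∈ sections I (m + 1) {i}}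
  zero_mem' := ⟨fun _ => Submodule.zero_mem _, Submodule.zero_mem _, fun i => by simp⟩
  add_mem' := by
    rintro q q' ⟨h1, h2, h3⟩ ⟨h1', h2', h3'⟩
    refine ⟨fun i => add_mem (h1 i) (h1' i), add_mem h2 h2', fun i => ?_⟩
    convert add_mem (h3 i) (h3' i) using 1
    simp only [Prod.snd_add, Prod.fst_add, Pi.add_apply, map_add]
    ring
  smul_mem' := by
    rintro c q ⟨h1, h2, h3⟩
    refine ⟨fun i => Submodule.smul_mem _ c (h1 i), Submodule.smul_mem _ c h2, fun i => ?_⟩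
    convert Submodule.smul_mem _ c (h3 i) using 1
    have : toFrac (c • q.2) = c • toFrac q.2 :=
      (IsScalarTower.toAlgHom K (MvPolynomial (Fin 3) K) _).toLinearMap.map_smul c q.2
    simp only [Prod.smul_snd, Prod.smul_fst, Pi.smul_apply, this, smul_sub, mul_smul_comm]

/-- x(gⱼ - gᵢ) = (h - x gᵢ) - (h - x gⱼ) lies in I, and x can be cancelled. -/
theorem IsPointsIdeal.sub_mem_sections_pair (hI : IsPointsIdeal x I)
    {q : (Fin 3 → FractionRing (MvPolynomial (Fin 3) K)) × MvPolynomial (Fin 3) K}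
    (hq : q ∈ liftedForms I m x) (i j : Fin 3) : q.1 j - q.1 i ∈ sections I m {i, j} := by
  have hi : ({i} : Finset (Fin 3)) ⊆ {i, j} := by simp
  have hj : ({j} : Finset (Fin 3)) ⊆ {i, j} := by simp
  refine hI.mem_sections_of_mul (sub_mem (sections_mono_right hj (hq.1 j))
    (sections_mono_right hi (hq.1 i))) ?_
  have := sub_mem (sections_mono_right hi (hq.2.2 i)) (sections_mono_right hj (hq.2.2 j))
  convert this using 1
  ring

/-- The cocycle of differences of the cochain. -/
def IsPointsIdeal.toCocycles (hI : IsPointsIdeal x I) (m : ℤ) :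
    liftedForms I m x →ₗ[K] cechCocycles I m where
  toFun q := ⟨fun i j => q.1.1 j - q.1.1 i, fun i j => hI.sub_mem_sections_pair q.2 i j,
    fun i j k => by ring⟩
  map_add' q q' := by
    ext i j
    simp only [Submodule.coe_add, Prod.fst_add, Pi.add_apply]
    ring
  map_smul' c q := by
    ext i j
    simp only [Submodule.coe_smul, Prod.smul_fst, Pi.smul_apply, RingHom.id_apply, smul_sub]

/-- The form of the pair. -/
def toForms (I : Ideal (MvPolynomial (Fin 3) K)) (m : ℤ) (x : MvPolynomial (Fin 3) K) :
    liftedForms I m x →ₗ[K] forms K (m + 1) :=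
  ((LinearMap.snd K _ _).comp (liftedForms I m x).subtype).codRestrict _ fun q => q.2.2.1

/-- A cocycle is the coboundary of a cochain g of O(m), and x^M g agrees on the scheme with a form
H. Above degree m + 1 every form is a + xc with a in I, so a factor x can be stripped from H until
only x g is left. -/
theorem IsPointsIdeal.toCocycles_surjective (hI : IsPointsIdeal x I) (hx : x.IsHomogeneous 1)
    (h0 : ∀ n : ℤ, m + 1 < n → hilbQuot (I ⊔ Ideal.span {x}) n = 0) :
    Function.Surjective (hI.toCocycles m) := by
  rintro ⟨f, hf, hcoc⟩
  obtain ⟨g, hg, hfg⟩ := exists_cochain (fun i j => sections_mono_left le_top (hf i j)) hcoc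
  obtain ⟨M, hM⟩ := exists_form_sub_mem_sections (m := m) hx hg fun i j => hfg i j ▸ hf i j
  have descent : ∀ k : ℕ, (∃ H ∈ forms K (m + 1 + k), ∀ i,
      toFrac H - toFrac (x ^ (k + 1)) * g i ∈ sections I (m + 1 + k) {i}) →
      ∃ H ∈ forms K (m + 1), ∀ i, toFrac H - toFrac x * g i ∈ sections I (m + 1) {i} := by
    intro k
    induction k with
    | zero => simp
    | succ k ih =>
      rintro ⟨H, hH, hs⟩
      refine ih ?_
      obtain ⟨a, ha, c, hc, rfl⟩ :=
        exists_of_hilbQuot_sup_eq_zero hI.isHomogeneous hx (h0 _ (by push_cast; omega)) hH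
      rw [show m + 1 + ((k + 1 : ℕ) : ℤ) - 1 = m + 1 + k by push_cast; ring] at hc
      refine ⟨c, hc, fun i => hI.mem_sections_of_mul (sub_mem (toFrac_mem_sections
        (by rwa [piece_top])) ?_) ?_⟩
      · have h1 : x ^ (k + 1) ∈ forms K (k + 1 : ℕ) := by
          simpa using pow_mem_forms (linear_mem_forms hx) (k + 1)
        have := toFrac_mul_mem_sections h1 (hg i)
        rwa [show m + ((k + 1 : ℕ) : ℤ) = m + 1 + k by push_cast; ring] at this
      · have := sub_mem (hs i) (toFrac_mem_sections (s := {i}) ha)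
        rw [show m + 1 + ((k + 1 : ℕ) : ℤ) = m + 1 + k + 1 by push_cast; ring] at this
        convert this using 1
        rw [pow_succ' x (k + 1), map_add, map_mul, map_mul]
        ring
  obtain ⟨H, hH, hs⟩ := hM
  -- One more factor x makes the exponent positive even when M = 0.
  obtain ⟨h, hh, hs⟩ := descent M ⟨x * H, by
      have := mul_mem_forms (linear_mem_forms hx) hH
      rwa [show 1 + (m + (M : ℤ)) = m + 1 + M by ring] at this, fun i => by
      have := toFrac_mul_mem_sections (linear_mem_forms hx) (hs i)
      rw [show m + (M : ℤ) + 1 = m + 1 + M by ring] at this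
      convert this using 1
      rw [pow_succ', map_mul, map_mul]
      ring⟩
  refine ⟨⟨(g, h), hg, hh, hs⟩, Subtype.ext (funext fun i => funext fun j => (hfg i j).symm)⟩

/-- On chart i, divide h by x locally: X i * h = a + xc with a in I, since its degree is m + 2, and
then c/X i serves as g i. -/
theorem toForms_surjective (hI : I.IsHomogeneous (forms K)) (hx : x.IsHomogeneous 1)
    (h0 : hilbQuot (I ⊔ Ideal.span {x}) (m + 2) = 0) :
    Function.Surjective (toForms I m x) := by
  rintro ⟨h, hh⟩
  have key : ∀ i : Fin 3, ∃ g ∈ sections ⊤ m {i},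
      toFrac h - toFrac x * g ∈ sections I (m + 1) {i} := by
    intro i
    have hX : toFrac (X i : MvPolynomial (Fin 3) K) ≠ 0 := toFrac_ne_zero (X_ne_zero i)
    have hXh := mul_mem_forms (X_mem_forms i) hh
    rw [show 1 + (m + 1) = m + 2 by ring] at hXh
    obtain ⟨a, ha, c, hc, hac⟩ := exists_of_hilbQuot_sup_eq_zero hI hx h0 hXh
    refine ⟨toFrac c / toFrac (X i), mem_sections_singleton (N := 1) (g := c) ?_ ?_,
      mem_sections_singleton (N := 1) (g := a) ?_ ?_⟩
    · rw [piece_top]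
      rwa [show m + 2 - 1 = m + ((1 : ℕ) : ℤ) by push_cast; ring] at hc
    · rw [pow_one, div_mul_cancel₀ _ hX]
    · rwa [show m + 2 = m + 1 + ((1 : ℕ) : ℤ) by push_cast; ring] at ha
    · rw [pow_one, sub_mul, mul_assoc, div_mul_cancel₀ _ hX, ← map_mul, ← map_mul, ← map_sub,
        mul_comm h, hac, add_sub_cancel_right]
  choose g hg hgh using key
  exact ⟨⟨(g, h), hg, hh, hgh⟩, rfl⟩

/-- If gⱼ - gᵢ = bⱼ - bᵢ with bᵢ in the ideal sheaf, the gᵢ - bᵢ glue to a form c, and h - xc is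
locally, hence globally, in I. Conversely h = a + xc gives bᵢ = gᵢ - c. -/
theorem IsPointsIdeal.mem_coboundaries_iff (hI : IsPointsIdeal x I) (hx : x.IsHomogeneous 1)
    (q : liftedForms I m x) :
    (hI.toCocycles m q : Fin 3 → Fin 3 → FractionRing (MvPolynomial (Fin 3) K)) ∈
      cechCoboundaries I m ↔ q.1.2 ∈ piece (I ⊔ Ideal.span {x}) (m + 1) := by
  rw [mem_piece_sup_iff hI.isHomogeneous hx, add_sub_cancel_right]
  constructor
  · rintro ⟨b, hb, hbq⟩
    have hconst : ∀ i, q.1.1 i - b i = q.1.1 0 - b 0 := by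
      intro i
      have : q.1.1 i - q.1.1 0 = b i - b 0 := hbq 0 i
      linear_combination this
    obtain ⟨c, hc, hcq⟩ := exists_form_of_mem_sections (m := m) (f := q.1.1 0 - b 0) fun i => by
      rw [← hconst i]
      exact sub_mem (q.2.1 i) (sections_mono_left le_top (hb i))
    have hxc : x * c ∈ forms K (m + 1) := by
      rw [add_comm]; exact mul_mem_forms (linear_mem_forms hx) hc
    refine ⟨q.1.2 - x * c, ⟨hI.mem_of_mem_sections hx (m := m + 1) fun i => ?_,
      sub_mem q.2.2.1 hxc⟩, c, hc, by ring⟩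
    have := add_mem (q.2.2.2 i) (toFrac_mul_mem_sections (linear_mem_forms hx) (hb i))
    convert this using 1
    rw [map_sub, map_mul, ← hcq, ← hconst i]
    ring
  · rintro ⟨a, ha, c, hc, hac⟩
    refine ⟨fun i => q.1.1 i - toFrac c, fun i => ?_, fun i j => ?_⟩
    · refine hI.mem_sections_of_mul (sub_mem (q.2.1 i)
        (toFrac_mem_sections (by rwa [piece_top]))) ?_
      have := sub_mem (toFrac_mem_sections (s := {i}) ha) (q.2.2.2 i)
      convert this using 1
      rw [hac, map_add, map_mul]
      ring
    · change q.1.1 j - q.1.1 i = _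
      ring

theorem nonempty_quotient_equiv {P B C : Type*} [AddCommGroup P] [AddCommGroup B] [AddCommGroup C]
    [Module K P] [Module K B] [Module K C] {f : P →ₗ[K] B} {g : P →ₗ[K] C}
    (hf : Function.Surjective f) (hg : Function.Surjective g)
    (h : LinearMap.ker f = LinearMap.ker g) : Nonempty (B ≃ₗ[K] C) :=
  ⟨(f.quotKerEquivOfSurjective hf).symm.trans
    ((Submodule.quotEquivOfEq _ _ h).trans (g.quotKerEquivOfSurjective hg))⟩

/-- Both sides are quotients of `liftedForms`, through the cocycle and through the form of a pair,
with the same kernel. -/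
theorem IsPointsIdeal.nonempty_cechH1_equiv (hI : IsPointsIdeal x I) (hx : x.IsHomogeneous 1)
    (h0 : ∀ n : ℤ, m + 1 < n → hilbQuot (I ⊔ Ideal.span {x}) n = 0) :
    Nonempty (cechH1 I m ≃ₗ[K] (forms K (m + 1) ⧸
      (piece (I ⊔ Ideal.span {x}) (m + 1)).submoduleOf (forms K (m + 1)))) := by
  refine nonempty_quotient_equiv (P := liftedForms I m x)
    (f := (Submodule.mkQ _).comp (hI.toCocycles m)) (g := (Submodule.mkQ _).comp (toForms I m x))
    ((Submodule.mkQ_surjective _).comp (hI.toCocycles_surjective hx h0))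
    ((Submodule.mkQ_surjective _).comp
      (toForms_surjective hI.isHomogeneous hx (h0 _ (by omega)))) ?_
  ext q
  rw [LinearMap.ker_comp, LinearMap.ker_comp, Submodule.ker_mkQ, Submodule.ker_mkQ]
  exact hI.mem_coboundaries_iff hx q

theorem IsPointsIdeal.finrank_cechH1 (hI : IsPointsIdeal x I) (hx : x.IsHomogeneous 1)
    (hx0 : x ≠ 0) {t : ℤ} {D : ℕ} (hD : ∀ n : ℤ, t ≤ n → hilbQuot I n = D) :
    Module.Finite K (cechH1 I (t - 1)) ∧
      (Module.finrank K (cechH1 I (t - 1)) : ℤ) = deltaHilbQuot I t := by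
  have h0 : ∀ n : ℤ, t - 1 + 1 < n → hilbQuot (I ⊔ Ideal.span {x}) n = 0 := by
    intro n hn
    have := hI.hilbQuot_eq hx hx0 n
    rw [hD n (by omega), hD (n - 1) (by omega)] at this
    omega
  obtain ⟨E⟩ := hI.nonempty_cechH1_equiv hx h0
  refine ⟨Module.Finite.equiv E.symm, ?_⟩
  rw [E.finrank_eq, sub_add_cancel]
  change (hilbQuot (I ⊔ Ideal.span {x}) t : ℤ) = _
  have := hI.hilbQuot_eq hx hx0 t
  rw [deltaHilbQuot]
  omega

end CechDimension

end PlaneFatPoints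

end

/-! ### The bounds for the fat point scheme -/

theorem mainTheorem7 {K : Type*} [Field K] [IsAlgClosed K]
    (A : PlaneFatPoints.FatPointScheme K)
    {r : ℕ} (F : Fin r → MvPolynomial (Fin 3) K)
    (hF_lin : ∀ i, (F i).IsHomogeneous 1) (hF_ne : ∀ i, F i ≠ 0)
    (hred : PlaneFatPoints.TotallyReduces A F)
    (hGMS : PlaneFatPoints.IsGMS (PlaneFatPoints.reductionVector A F))
    (t : ℕ) (ht : PlaneFatPoints.initialDegree A.ideal ≤ t)
    (ht' : t < PlaneFatPoints.regularity A.ideal)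
    (j : Fin (r + 1))
    (hj : IsGreatest {k : Fin (r + 1) | ∀ i : Fin (r + 1), 1 ≤ (i : ℕ) → i ≤ k →
      PlaneFatPoints.hilbIdeal (PlaneFatPoints.residualIdeal A F i) ((t : ℤ) - ((i : ℕ) : ℤ)) =
        PlaneFatPoints.hilbIdeal A.ideal (t : ℤ)} j)
    (e : ℤ)
    (he : e = PlaneFatPoints.deltaHilbQuot (PlaneFatPoints.residualIdeal A F j)
      ((t : ℤ) - ((j : ℕ) : ℤ))) :
    (Module.Finite K (PlaneFatPoints.cechH1 (PlaneFatPoints.residualIdeal A F j)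
        ((t : ℤ) - ((j : ℕ) : ℤ) - 1)) ∧
      (Module.finrank K (PlaneFatPoints.cechH1 (PlaneFatPoints.residualIdeal A F j)
        ((t : ℤ) - ((j : ℕ) : ℤ) - 1)) : ℤ) = e) ∧
    ((PlaneFatPoints.hilbIdeal A.ideal ((t : ℤ) + 1) : ℤ) -
          (PlaneFatPoints.hilbIdeal (PlaneFatPoints.residualIdeal A F j)
            ((t : ℤ) - ((j : ℕ) : ℤ) + 1) : ℤ)) +
        max (2 * e - (t : ℤ) + ((j : ℕ) : ℤ)) 0 ≤
      (PlaneFatPoints.nuSucc A.ideal t : ℤ) ∧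
    (PlaneFatPoints.nuSucc A.ideal t : ℤ) ≤
      ((PlaneFatPoints.hilbIdeal A.ideal ((t : ℤ) + 1) : ℤ) -
          (PlaneFatPoints.hilbIdeal (PlaneFatPoints.residualIdeal A F j)
            ((t : ℤ) - ((j : ℕ) : ℤ) + 1) : ℤ)) + e := by

  obtain ⟨x, hx, hx0, hA⟩ := PlaneFatPoints.exists_isPointsIdeal A
  have hJ := PlaneFatPoints.isPointsIdeal_residualIdeal hA hF_lin j
  have hne := PlaneFatPoints.piece_ne_bot_of_initialDegree_le hA ht
  have heq : PlaneFatPoints.hilbIdeal (PlaneFatPoints.residualIdeal A F j)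
      ((t : ℤ) - ((j : ℕ) : ℤ)) = PlaneFatPoints.hilbIdeal A.ideal (t : ℤ) := by
    -- The condition defining j starts at index 1, so index 0 is treated apart.
    rcases Nat.eq_zero_or_pos (j : ℕ) with h0 | h0
    · have : j = 0 := Fin.ext h0
      subst this
      simp [PlaneFatPoints.residualIdeal_zero]
    · exact hj.1 j h0 le_rfl
  have hne' : PlaneFatPoints.piece (PlaneFatPoints.residualIdeal A F j)
      ((t : ℤ) - ((j : ℕ) : ℤ)) ≠ ⊥ := by
    intro hb
    rw [PlaneFatPoints.hilbIdeal, hb, finrank_bot] at heq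
    exact hne (Submodule.finrank_eq_zero.1 heq.symm)
  obtain ⟨u, hut⟩ : ∃ u : ℕ, (t : ℤ) - ((j : ℕ) : ℤ) = u := by
    refine ⟨((t : ℤ) - ((j : ℕ) : ℤ)).toNat, (Int.toNat_of_nonneg ?_).symm⟩
    by_contra hlt
    exact hne' (eq_bot_iff.2 ((PlaneFatPoints.piece_le_forms _ _).trans
      (PlaneFatPoints.forms_of_neg (by omega)).le))
  have hred_le : ∀ k : Fin r, k.castSucc = j →
      PlaneFatPoints.reductionVector A F k ≤ (t : ℤ) - ((j : ℕ) : ℤ) := by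
    rintro k rfl
    refine hJ.degree_sup_le_of_ne (hF_lin k) (hF_ne k) fun h => ?_
    rw [← PlaneFatPoints.residualIdeal_succ, heq] at h
    -- Equality of dimensions at the next residual would put j + 1 into the set of which j is the
    -- greatest element.
    refine (Fin.castSucc_lt_succ (i := k)).not_ge (hj.2 fun i hi hik => ?_)
    rcases hik.eq_or_lt with rfl | hlt
    · rw [← h, Fin.val_succ, Fin.val_castSucc]
      push_cast
      rw [sub_sub]
    · exact hj.1 i hi (Fin.le_castSucc_iff.2 hlt)
  obtain ⟨D, hD⟩ := PlaneFatPoints.hilbQuot_residualIdeal_eq hA hx hx0 hF_lin hF_ne hred hGMS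
    hred_le
  obtain ⟨G, hG, hG0, hGA⟩ := PlaneFatPoints.product_mul_mem A F hF_lin hF_ne j
  have hmul := PlaneFatPoints.finrank_mul_forms_one_eq hG hG0 hGA heq
  have hnu := PlaneFatPoints.nuSucc_add A.ideal t
  have hH1 := hJ.finrank_cechH1 hx hx0 hD
  rw [hut] at hmul hD hne' he hH1 ⊢
  have hb := hJ.generators_bounds hx hx0 hD hne'
  rw [← he] at hb hH1
  refine ⟨hH1, ?_⟩
  -- ν_{t+1}(A) + dim J_u R_1 = h_{I_A}(t+1), and the bounds for J supply the rest.
  omega
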